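/- Let $\mathbb{R}^4_2$ be $\mathbb{R}^4$ with the metric $\langle a,b\rangle=-a_1b_1-a_2b_2+a_3b_3+a_4b_4$ and standard basis $e$. Let $\mathbb{C}H^3_1$ be the set of complex lines in $\mathbb{C}^4$ on which the Hermitian extension of this metric is negative definite, with the metric $g$ that makes the Hopf map $\pi:\{z\in\mathbb{C}^4 : \langle z,z\rangle=-1\}\to\mathbb{C}H^3_1$, $z\mapsto[z]$, a pseudo-Riemannian submersion and the complex structure $J$ induced by multiplication by $i$ on horizontal vectors. The complex hyperbolic quadric $Q^{2*}$ is the connected component of $[(1,i,0,0)]$ in $\{[z]\in\mathbb{C}H^3_1 : -z_1^2-z_2^2+z_3^2+z_4^2=0\}$, with the induced metric and complex structure. A negative definite oriented $2$-plane $P$ in $\mathbb{R}^4_2$ is identified with the point $[u_1+iu_2]$ of this quadric, where $u_P=(u_1,u_2,u_3,u_4)$ denotes any positively oriented pseudo-orthonormal basis of $\mathbb{R}^4_2$ (with $\langle u_1,u_1\rangle=\langle u_2,u_2\rangle=-1$, $\langle u_3,u_3\rangle=\langle u_4,u_4\rangle=1$) such that $(u_1,u_2)$ is a positively oriented basis of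 $P$; in this way $Q^{2*}$ is a connected component of the Grassmannian of negative definite oriented $2$-planes. Equip $\bigwedge^2\mathbb{R}^4_2$ with the metric $\langle\!\langle v_1\wedge w_1,v_2\wedge w_2\rangle\!\rangle=-\langle v_1,v_2\rangle\langle w_1,w_2\rangle+\langle v_1,w_2\rangle\langle v_2,w_1\rangle$ and the Hodge star operator given by $*^2=\mathrm{id}$, $*(e_1\wedge e_2)=e_4\wedge e_3$, $*(e_1\wedge e_3)=e_4\wedge e_2$, $*(e_1\wedge e_4)=e_2\wedge e_3$, and let $\bigwedge^2_\pm\mathbb{R}^4_2$ be its $\pm1$-eigenspaces (self-dual and anti-self-dual two-vectors). For a basis $u=(u_1,u_2,u_3,u_4)$ put $$E_{1\pm}(u)=\tfrac1{\sqrt2}(u_1\wedge u_2\pm u_4\wedge u_3),\quad E_{2\pm}(u)=\tfrac1{\sqrt2}(u_1\wedge u_3\pm u_4\wedge u_2),\quad E_{3\pm}(u)=\tfrac1{\sqrt2}(u_1\wedge u_4\pm u_2\wedge u_3).$$ For $c<0$ let $\mathbb{H}^2_\pm(c)=\{\sum_i x_iE_{i\pm}(e) : -x_1^2+x_2^2+x_3^2=1/c,\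 x_1>0\}\subset\bigwedge^2_\pm\mathbb{R}^4_2$, the hyperbolic plane of curvature $c$ with the metric induced by $\langle\!\langle\cdot,\cdot\rangle\!\rangle$. Give $\mathbb{H}^2(c)\times\mathbb{H}^2(c):=\mathbb{H}^2_+(c)\times\mathbb{H}^2_-(c)$ the product metric and the complex structure $J_{(x_1,x_2)}(v_1,v_2)=\sqrt{-c}\,(x_1\boxtimes v_1,-x_2\boxtimes v_2)$, where, in coordinates with respect to $E_{1\pm}(e),E_{2\pm}(e),E_{3\pm}(e)$, $a\boxtimes b=(a_3b_2-a_2b_3,\,a_3b_1-a_1b_3,\,a_1b_2-a_2b_1)$. **Proposition.** For every negative definite oriented $2$-plane $P$ in $\mathbb{R}^4_2$ a basis $u_P$ as above exists, $\frac12E_{1+}(u_P)$ and $\frac12E_{1-}(u_P)$ do not depend on its choice and lie in $\bigwedge^2_+\mathbb{R}^4_2$ and $\bigwedge^2_-\mathbb{R}^4_2$ respectively, and $P\mapsto[u_1+iu_2]$ is a well-defined bijection onto the set of lines in $\mathbb{C}H^3_1$ with $-z_1^2-z_2^2+z_3^2+z_4^2=0$. The map $$\phi: Q^{2*}\to(\textstyle\bigwedge^2_+\mathbb{R}^4_2)\oplus(\bigwedge^2_-\mathbb{R}^4_2),\qquad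 P\mapsto\left(\tfrac12E_{1+}(u_P),\tfrac12E_{1-}(u_P)\right)$$ is a holomorphic isometry of $Q^{2*}$ onto $\mathbb{H}^2(-4)\times\mathbb{H}^2(-4)$, that is, a diffeomorphism onto it whose differential preserves the metrics and commutes with the complex structures. -/

import Mathlib

open scoped ContDiff LinearAlgebra.Projectivization ComplexConjugate

noncomputable section

namespace HypQuadric

/-! ### The pseudo-Euclidean space of dimension 4 and index 2, and its two-vectors -/

/-- The real vector space underlying `ℝ⁴₂`. -/
abbrev R4 := Fin 4 → ℝ

/-- The metric `-a₁b₁ - a₂b₂ + a₃b₃ + a₄b₄` of `ℝ⁴₂`. -/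
def form : LinearMap.BilinForm ℝ R4 :=
  Matrix.toBilin' (Matrix.diagonal ![-1, -1, 1, 1])

theorem form_apply (v w : R4) :
    form v w = -(v 0 * w 0) - v 1 * w 1 + v 2 * w 2 + v 3 * w 3 := by
  simp [form, Matrix.toBilin'_apply', Matrix.mulVec_diagonal, dotProduct, Fin.sum_univ_four]
  ring

/-- The signs of a pseudo-orthonormal basis of `ℝ⁴₂`. -/
def sgn : Fin 4 → ℝ := ![-1, -1, 1, 1]

/-- `u` is a positively oriented pseudo-orthonormal basis of `ℝ⁴₂`
(two timelike vectors followed by two spacelike ones). -/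
def IsPosPseudoOrthonormal (u : Fin 4 → R4) : Prop :=
  (∀ i j, form (u i) (u j) = if i = j then sgn i else 0) ∧ 0 < (Matrix.of u).det

/-- The space of two-vectors `⋀² ℝ⁴₂`. -/
abbrev TwoVec := ⋀[ℝ]^2 R4

/-- The coordinates of a two-vector in the basis `eᵢ ∧ eⱼ`, `i < j`. -/
def twoVecCoords : TwoVec ≃ₗ[ℝ] (Set.powersetCard (Fin 4) 2 → ℝ) :=
  ((Pi.basisFun ℝ (Fin 4)).exteriorPower 2).equivFun

/-- An auxiliary norm on the finite-dimensional space `⋀² ℝ⁴₂`, used only to speak of open sets,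
limits and derivatives (which do not depend on the norm). -/
instance : NormedAddCommGroup TwoVec :=
  NormedAddCommGroup.induced TwoVec (Set.powersetCard (Fin 4) 2 → ℝ) twoVecCoords.toLinearMap
    twoVecCoords.injective

instance : NormedSpace ℝ TwoVec :=
  NormedSpace.induced ℝ TwoVec (Set.powersetCard (Fin 4) 2 → ℝ) twoVecCoords.toLinearMap

/-- The two-vector `v ∧ w`. -/
def wedge (v w : R4) : TwoVec := exteriorPower.ιMulti ℝ 2 ![v, w]

/-- The metric on two-vectors with
`⟪v₁ ∧ w₁, v₂ ∧ w₂⟫ = -⟨v₁, v₂⟩⟨w₁, w₂⟩ + ⟨v₁, w₂⟩⟨v₂, w₁⟩`. -/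
def form2 : LinearMap.BilinForm ℝ TwoVec :=
  -(exteriorPower.pairingDual ℝ R4 2 ∘ₗ exteriorPower.map 2 form)

theorem form2_wedge (v₁ w₁ v₂ w₂ : R4) :
    form2 (wedge v₁ w₁) (wedge v₂ w₂)
      = -(form v₁ v₂ * form w₁ w₂) + form v₁ w₂ * form v₂ w₁ := by
  simp only [form2, wedge, LinearMap.neg_apply, LinearMap.comp_apply,
    exteriorPower.map_apply_ιMulti, exteriorPower.pairingDual_ιMulti_ιMulti,
    Matrix.det_fin_two, Matrix.of_apply, Function.comp_apply,
    Matrix.cons_val_zero, Matrix.cons_val_one]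
  simp only [form_apply]
  ring

/-- The standard basis of `ℝ⁴₂`. -/
def e : Fin 4 → R4 := fun i => Pi.single i 1

/-- The Hodge star operator of `⋀² ℝ⁴₂`: the linear involution with
`∗(e₁ ∧ e₂) = e₄ ∧ e₃`, `∗(e₁ ∧ e₃) = e₄ ∧ e₂`, `∗(e₁ ∧ e₄) = e₂ ∧ e₃`
(see `hodgeStar_e` below). -/
def hodgeStar : TwoVec →ₗ[ℝ] TwoVec :=
  -(form2 (wedge (e 0) (e 1))).smulRight (wedge (e 3) (e 2))
  - (form2 (wedge (e 3) (e 2))).smulRight (wedge (e 0) (e 1))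
  + (form2 (wedge (e 0) (e 2))).smulRight (wedge (e 3) (e 1))
  + (form2 (wedge (e 3) (e 1))).smulRight (wedge (e 0) (e 2))
  + (form2 (wedge (e 0) (e 3))).smulRight (wedge (e 1) (e 2))
  + (form2 (wedge (e 1) (e 2))).smulRight (wedge (e 0) (e 3))

theorem hodgeStar_e :
    hodgeStar (wedge (e 0) (e 1)) = wedge (e 3) (e 2) ∧
    hodgeStar (wedge (e 0) (e 2)) = wedge (e 3) (e 1) ∧
    hodgeStar (wedge (e 0) (e 3)) = wedge (e 1) (e 2) ∧
    hodgeStar (wedge (e 3) (e 2)) = wedge (e 0) (e 1) ∧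
    hodgeStar (wedge (e 3) (e 1)) = wedge (e 0) (e 2) ∧
    hodgeStar (wedge (e 1) (e 2)) = wedge (e 0) (e 3) := by
  simp [hodgeStar, form2_wedge, form_apply, e]

/-- The self-dual two-vectors. -/
def selfDual : Submodule ℝ TwoVec := LinearMap.ker (hodgeStar - LinearMap.id)

/-- The anti-self-dual two-vectors. -/
def antiSelfDual : Submodule ℝ TwoVec := LinearMap.ker (hodgeStar + LinearMap.id)

/-- `E s i u` is `E_{(i+1)+}(u)` for `s = 1` and `E_{(i+1)-}(u)` for `s = -1`. -/
def E (s : ℝ) (i : Fin 3) (u : Fin 4 → R4) : TwoVec :=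
  (1 / √2) • ![wedge (u 0) (u 1) + s • wedge (u 3) (u 2),
    wedge (u 0) (u 2) + s • wedge (u 3) (u 1),
    wedge (u 0) (u 3) + s • wedge (u 1) (u 2)] i

/-! ### The product of two hyperbolic planes -/

/-- The subset `{x₁ E_{1±}(e) + x₂ E_{2±}(e) + x₃ E_{3±}(e) | -x₁² + x₂² + x₃² = 1/c, x₁ > 0}`,
with the sign `s = ±1`: the hyperbolic plane `H²(c)` inside the self-dual, respectively
anti-self-dual, two-vectors. -/
def hypPlane (s c : ℝ) : Set TwoVec :=
  {x | ∃ y : Fin 3 → ℝ, x = ∑ i, y i • E s i e ∧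
    -(y 0) ^ 2 + (y 1) ^ 2 + (y 2) ^ 2 = 1 / c ∧ 0 < y 0}

/-- The Lorentzian cross product on `ℝ³₁`. -/
def cross (a b : Fin 3 → ℝ) : Fin 3 → ℝ :=
  ![a 2 * b 1 - a 1 * b 2, a 2 * b 0 - a 0 * b 2, a 0 * b 1 - a 1 * b 0]

/-- The coordinates of a (anti-)self-dual two-vector in the pseudo-orthonormal basis
`E_{1±}(e), E_{2±}(e), E_{3±}(e)`. -/
def coords (s : ℝ) (x : TwoVec) : Fin 3 → ℝ :=
  ![-form2 x (E s 0 e), form2 x (E s 1 e), form2 x (E s 2 e)]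

/-- The Lorentzian cross product of `ℝ³₁` carried over to the (anti-)self-dual two-vectors by the
basis `E_{1±}(e), E_{2±}(e), E_{3±}(e)`. -/
def cross2 (s : ℝ) (x v : TwoVec) : TwoVec :=
  ∑ i, cross (coords s x) (coords s v) i • E s i e

/-- The product metric on `H²(c) × H²(c)`, evaluated on tangent vectors. -/
def metricHH (v w : TwoVec × TwoVec) : ℝ := form2 v.1 w.1 + form2 v.2 w.2

/-- The complex structure `J_x v = √(-c) (x₁ ⊠ v₁, -x₂ ⊠ v₂)` of `H²(c) × H²(c)`,
evaluated on a tangent vector `v` at `x`. -/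
def complexStructureHH (c : ℝ) (x v : TwoVec × TwoVec) : TwoVec × TwoVec :=
  √(-c) • (cross2 1 x.1 v.1, -cross2 (-1) x.2 v.2)

/-! ### The complex hyperbolic quadric as a hypersurface of complex anti-de Sitter space -/

/-- The complex vector space underlying `ℂ⁴₂`. -/
abbrev C4 := Fin 4 → ℂ

/-- The Hermitian form of `ℂ⁴₂`; its real part is the metric of `ℂ⁴₂ ≅ ℝ⁸₄`. -/
def herm (z w : C4) : ℂ :=
  -(z 0 * conj (w 0)) - z 1 * conj (w 1) + z 2 * conj (w 2) + z 3 * conj (w 3)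

/-- The complex bilinear extension of the metric of `ℝ⁴₂`. -/
def quad (z w : C4) : ℂ := -(z 0 * w 0) - z 1 * w 1 + z 2 * w 2 + z 3 * w 3

/-- The quotient topology on complex projective space. -/
instance : TopologicalSpace (ℙ ℂ C4) :=
  inferInstanceAs (TopologicalSpace (Quotient (projectivizationSetoid ℂ C4)))

/-- Complex anti-de Sitter space: the complex lines in `ℂ⁴₂` on which the metric is
negative definite. -/
def CH31 : Set (ℙ ℂ C4) := {ℓ | ∀ z ∈ ℓ.submodule, z ≠ 0 → (herm z z).re < 0}

/-- The pseudosphere `{z | ⟨z, z⟩ = -1}` in `ℂ⁴₂ ≅ ℝ⁸₄`. -/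
def H73 : Set C4 := {z | (herm z z).re = -1}

theorem ne_zero_of_mem_H73 {z : C4} (hz : z ∈ H73) : z ≠ 0 := by
  rintro rfl
  simp [H73, herm] at hz

/-- The Hopf fibration `z ↦ [z]`. -/
def hopf (z : H73) : ℙ ℂ C4 := Projectivization.mk ℂ z.1 (ne_zero_of_mem_H73 z.2)

/-- The lines of complex anti-de Sitter space that lie on the quadric
`-z₁² - z₂² + z₃² + z₄² = 0`. -/
def quadric : Set (ℙ ℂ C4) := {ℓ | ℓ ∈ CH31 ∧ ∀ z ∈ ℓ.submodule, quad z z = 0}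

/-- The point `[(1, i, 0, 0)]`. -/
def basePoint : ℙ ℂ C4 :=
  Projectivization.mk ℂ ![1, Complex.I, 0, 0] (fun h => by simpa using congrFun h 0)

theorem basePoint_mem_quadric : basePoint ∈ quadric := by
  constructor
  · intro z hz hz0
    rw [basePoint, Projectivization.submodule_mk, Submodule.mem_span_singleton] at hz
    obtain ⟨a, rfl⟩ := hz
    have ha : a ≠ 0 := by rintro rfl; simp at hz0
    have : 0 < Complex.normSq a := Complex.normSq_pos.2 ha
    simp [herm, Complex.normSq_apply] at this ⊢
    nlinarith
  · intro z hz
    rw [basePoint, Projectivization.submodule_mk, Submodule.mem_span_singleton] at hz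
    obtain ⟨a, rfl⟩ := hz
    simp [quad]
    linear_combination (-(a ^ 2)) * Complex.I_sq

/-- The complex hyperbolic quadric `Q^{2*}`: the connected component of `[(1, i, 0, 0)]`. -/
def Q2star : Set (ℙ ℂ C4) := connectedComponentIn quadric basePoint

theorem Q2star_subset_quadric : Q2star ⊆ quadric := connectedComponentIn_subset _ _

/-- The part of the pseudosphere lying over `Q^{2*}`. -/
def Q2starLift : Set C4 := {z | ∃ hz : z ∈ H73, hopf ⟨z, hz⟩ ∈ Q2star}

/-- The restricted Hopf fibration `π` onto `Q^{2*}`. -/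
def proj (z : Q2starLift) : Q2star := ⟨hopf ⟨z.1, z.2.1⟩, z.2.2⟩

theorem mem_submodule_of_proj_eq {z : Q2starLift} {ℓ : Q2star} (h : proj z = ℓ) :
    z.1 ∈ ℓ.1.submodule := by
  subst h
  simp only [proj, hopf, Projectivization.submodule_mk]
  exact Submodule.mem_span_singleton_self _

/-- The tangent space at `ℓ` of the quadric, as the complex space of those linear maps
`A : ℓ → ℂ⁴₂` for which each `A z` is horizontal for the Hopf fibration (that is, orthogonal to
`z` and `iz`) and tangent to the quadric. For a unit `z ∈ ℓ`, the vector `A z` is the horizontal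
lift at `z` of the tangent vector `A`, that is `A = (dπ)_z (A z)`. -/
def tangentQ (ℓ : ℙ ℂ C4) : Submodule ℂ (ℓ.submodule →ₗ[ℂ] C4) where
  carrier := {A | ∀ z : ℓ.submodule, herm (A z) z = 0 ∧ quad z (A z) = 0}
  add_mem' := by
    intro A B hA hB z
    obtain ⟨h1, h2⟩ := hA z
    obtain ⟨h3, h4⟩ := hB z
    simp only [herm, quad, LinearMap.add_apply, Pi.add_apply] at *
    exact ⟨by linear_combination h1 + h3, by linear_combination h2 + h4⟩
  zero_mem' := by intro z; simp [herm, quad]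
  smul_mem' := by
    intro a A hA z
    obtain ⟨h1, h2⟩ := hA z
    simp only [herm, quad, LinearMap.smul_apply, Pi.smul_apply, smul_eq_mul] at *
    exact ⟨by linear_combination a * h1, by linear_combination a * h2⟩

/-- The metric `g` of `Q^{2*}`, which makes the Hopf fibration a pseudo-Riemannian submersion: it
is the real part of the Hermitian form on horizontal lifts at unit points (see `metricQ_eq`). -/
def metricQ (ℓ : ℙ ℂ C4) (A B : tangentQ ℓ) : ℝ :=
  (herm (A.1 ⟨ℓ.rep, by rw [ℓ.submodule_eq]; exact Submodule.mem_span_singleton_self _⟩)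
    (B.1 ⟨ℓ.rep, by rw [ℓ.submodule_eq]; exact Submodule.mem_span_singleton_self _⟩)).re
    / (-(herm ℓ.rep ℓ.rep).re)

theorem herm_smul_smul (a : ℂ) (z w : C4) :
    herm (a • z) (a • w) = (Complex.normSq a : ℂ) * herm z w := by
  simp only [herm, Pi.smul_apply, smul_eq_mul, map_mul, Complex.normSq_eq_conj_mul_self]
  ring

/-- At every unit vector `z` of the line `ℓ`, the metric `g` is computed from the horizontal
lifts at `z`. -/
theorem metricQ_eq (ℓ : ℙ ℂ C4) (A B : tangentQ ℓ) (z : ℓ.submodule) (hz : z.1 ∈ H73) :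
    metricQ ℓ A B = (herm (A.1 z) (B.1 z)).re := by
  obtain ⟨z, hzl⟩ := z
  have hr : ℓ.rep ∈ ℓ.submodule := by
    rw [ℓ.submodule_eq]; exact Submodule.mem_span_singleton_self _
  have hzl' := hzl
  rw [ℓ.submodule_eq, Submodule.mem_span_singleton] at hzl'
  obtain ⟨a, rfl⟩ := hzl'
  have hs : (⟨a • ℓ.rep, hzl⟩ : ℓ.submodule) = a • ⟨ℓ.rep, hr⟩ := rfl
  have hz' : Complex.normSq a * (herm ℓ.rep ℓ.rep).re = -1 := by
    have := hz
    simpa [H73, herm_smul_smul, Complex.mul_re] using this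
  have hne : (herm ℓ.rep ℓ.rep).re ≠ 0 := by
    intro h; rw [h] at hz'; norm_num at hz'
  rw [hs, map_smul, map_smul, herm_smul_smul, metricQ, Complex.re_ofReal_mul,
    div_eq_iff (neg_ne_zero.2 hne)]
  linear_combination (herm (A.1 ⟨ℓ.rep, hr⟩) (B.1 ⟨ℓ.rep, hr⟩)).re * hz'

/-- The complex structure `J` of `Q^{2*}`, induced by multiplication by `i` on horizontal
vectors. -/
def complexStructureQ (ℓ : ℙ ℂ C4) (A : tangentQ ℓ) : tangentQ ℓ := Complex.I • A

/-- A map on `Q^{2*}` is smooth if its composition with the submersion `π` is smooth, that is,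
locally the restriction of a smooth map on an open subset of `ℂ⁴`. -/
def IsSmoothOnQ (f : Q2star → TwoVec × TwoVec) : Prop :=
  ∀ z : Q2starLift, ∃ (U : Set C4) (F : C4 → TwoVec × TwoVec), IsOpen U ∧ z.1 ∈ U ∧
    ContDiffOn ℝ ∞ F U ∧ ∀ w : Q2starLift, w.1 ∈ U → f (proj w) = F w.1

/-- A map `h` into `Q^{2*}`, defined on a subset `N` of `⋀² ℝ⁴₂ × ⋀² ℝ⁴₂`, is smooth if locally
it is `π ∘ σ` for the restriction `σ` to `N` of a smooth map on an open subset. -/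
def IsSmoothIntoQ (N : Set (TwoVec × TwoVec)) (h : N → Q2star) : Prop :=
  ∀ x : N, ∃ (U : Set (TwoVec × TwoVec)) (σ : TwoVec × TwoVec → C4), IsOpen U ∧ x.1 ∈ U ∧
    ContDiffOn ℝ ∞ σ U ∧
    ∀ y : N, y.1 ∈ U → ∃ hy : σ y.1 ∈ Q2starLift, proj ⟨σ y.1, hy⟩ = h y

/-- `D` is the differential of `f` at `ℓ`: whenever a curve `γ` over `Q^{2*}` starts on the fibre
over `ℓ` with the velocity equal to the horizontal lift of a tangent vector `A`, the curve
`f ∘ π ∘ γ` has initial velocity `D A`. -/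
def HasDifferentialAt (f : Q2star → TwoVec × TwoVec) (ℓ : Q2star)
    (D : tangentQ ℓ.1 →ₗ[ℝ] TwoVec × TwoVec) : Prop :=
  ∀ (A : tangentQ ℓ.1) (γ : ℝ → Q2starLift) (hγ : proj (γ 0) = ℓ),
    HasDerivAt (fun t => (γ t).1) (A.1 ⟨(γ 0).1, mem_submodule_of_proj_eq hγ⟩) 0 →
    HasDerivAt (fun t => f (proj (γ t))) (D A) 0

/-- `f` is a holomorphic isometry of `Q^{2*}` onto `H²(c) × H²(c)`: a diffeomorphism whose
differential preserves the metrics and commutes with the complex structures. -/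
structure IsHolomorphicIsometry (c : ℝ) (f : Q2star → TwoVec × TwoVec) : Prop where
  injective : Function.Injective f
  range_eq : Set.range f = hypPlane 1 c ×ˢ hypPlane (-1) c
  smooth : IsSmoothOnQ f
  smooth_inverse : ∃ h : ↥(hypPlane 1 c ×ˢ hypPlane (-1) c) → Q2star,
    (∀ x, f (h x) = x.1) ∧ IsSmoothIntoQ (hypPlane 1 c ×ˢ hypPlane (-1) c) h
  differential : ∀ ℓ : Q2star, ∃ D : tangentQ ℓ.1 →ₗ[ℝ] TwoVec × TwoVec,
    HasDifferentialAt f ℓ D ∧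
    (∀ A B, metricHH (D A) (D B) = metricQ ℓ.1 A B) ∧
    (∀ A, D (complexStructureQ ℓ.1 A) = complexStructureHH c (f ℓ) (D A))

/-! ### Negative definite oriented two-planes -/

/-- A negative definite oriented two-plane in `ℝ⁴₂`. -/
structure NegOrientedPlane where
  plane : Submodule ℝ R4
  finrank_eq : Module.finrank ℝ plane = 2
  neg_def : ∀ v ∈ plane, v ≠ 0 → form v v < 0
  orientation : Orientation ℝ plane (Fin 2)

/-- `u` is a positively oriented pseudo-orthonormal basis of `ℝ⁴₂` whose first two vectors form a
positively oriented basis of `P`. -/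
def IsAdaptedBasis (P : NegOrientedPlane) (u : Fin 4 → R4) : Prop :=
  IsPosPseudoOrthonormal u ∧
    ∃ b : Module.Basis (Fin 2) ℝ P.plane,
      (b 0 : R4) = u 0 ∧ (b 1 : R4) = u 1 ∧ b.orientation = P.orientation

/-- The vector `u₁ + i u₂` of `ℂ⁴₂`. -/
def complexVec (u : Fin 4 → R4) : C4 := fun k => (u 0 k : ℂ) + Complex.I * (u 1 k : ℂ)

end HypQuadric

end

noncomputable section

namespace HypQuadric

/-! ### Two-vectors in coordinates -/

/-! Put `z = u₁ + i u₂` and `ω = Re z ∧ Im z`. For a positively oriented pseudo-orthonormal basis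
`u₄ ∧ u₃ = ∗ω` (`IsPosPseudoOrthonormal.minors`), so `E_{1±}(u) = (ω ± ∗ω)/√2` depends on `z` alone.
Since `az` has two-vector `|a|² ω`, it is a function of the line `[z]` once the norm of `z` is
fixed. An adapted basis has `⟨z, z⟩ = -2` and a Hopf lift has `⟨z, z⟩ = -1`; the factor `½` in `φ`
is exactly this discrepancy. Conversely `quad z z = 0` says that `Re z` and `Im z` are orthogonal of
equal norm, which makes oriented planes the same as points of the quadric.

The image lies on the hyperboloids by Cauchy–Binet and the Plücker relation
(`dualCoords_hyperboloid`). The inverse is explicit: `z̅₁ z` is polynomial in the Plücker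
coordinates of a unit `z` (`secVec_plucker`), and `z₁` never vanishes on the quadric. Dividing by
`|z₁|` gives a smooth section `hopfSection` over the product of the hyperbolic planes.

The component is found from `plucker_sq_ge`: the first Plücker coordinate has no zero on the
quadric, so its sign splits it into two open pieces, and the section exhibits the positive piece as
a continuous image of `ℝ⁴` (`Q2star_eq`).

The differential sends a horizontal `w` to the dual parts of `Re w ∧ Im z + Re z ∧ Im w`.
Cauchy–Binet gives the metric (`lorentz_polarCoords`). The cross product is the bracket of
two-vectors, and bracketing with `ω` acts on these tangent vectors as `½ i` (`polarCoords_I_smul`),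
which gives the complex structure. -/

theorem update_cons_zero (v w x : R4) : Function.update ![v, w] 0 x = ![x, w] := by
  ext i
  fin_cases i <;> simp

theorem wedge_add_left (v v' w : R4) : wedge (v + v') w = wedge v w + wedge v' w := by
  have h := (exteriorPower.ιMulti ℝ 2 (M := R4)).map_update_add ![v, w] 0 v v'
  simpa only [wedge, update_cons_zero] using h

theorem wedge_smul_left (c : ℝ) (v w : R4) : wedge (c • v) w = c • wedge v w := by
  have h := (exteriorPower.ιMulti ℝ 2 (M := R4)).map_update_smul ![v, w] 0 c v
  simpa only [wedge, update_cons_zero] using h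

theorem wedge_self (v : R4) : wedge v v = 0 :=
  (exteriorPower.ιMulti ℝ 2 (M := R4)).map_eq_zero_of_eq ![v, v] (i := 0) (j := 1) rfl
    (by decide)

theorem wedge_swap (v w : R4) : wedge w v = -wedge v w := by
  have h := (exteriorPower.ιMulti ℝ 2 (M := R4)).map_swap ![v, w] (i := 0) (j := 1) (by decide)
  rw [wedge, wedge, ← h]
  congr 1
  ext i j
  fin_cases i <;> rfl

theorem wedge_add_right (v w w' : R4) : wedge v (w + w') = wedge v w + wedge v w' := by
  rw [wedge_swap, wedge_add_left, wedge_swap v w, wedge_swap v w']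
  abel

theorem wedge_smul_right (c : ℝ) (v w : R4) : wedge v (c • w) = c • wedge v w := by
  rw [wedge_swap, wedge_smul_left, wedge_swap v w, smul_neg, neg_neg]

theorem eq_sum_e (v : R4) : v = v 0 • e 0 + v 1 • e 1 + v 2 • e 2 + v 3 • e 3 := by
  ext i
  fin_cases i <;> simp [e]

/-- A two-vector `v ∧ w` in terms of its Plücker coordinates. -/
theorem wedge_eq_sum (v w : R4) :
    wedge v w = (v 0 * w 1 - v 1 * w 0) • wedge (e 0) (e 1)
      + (v 0 * w 2 - v 2 * w 0) • wedge (e 0) (e 2)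
      + (v 0 * w 3 - v 3 * w 0) • wedge (e 0) (e 3)
      + (v 1 * w 2 - v 2 * w 1) • wedge (e 1) (e 2)
      + (v 3 * w 1 - v 1 * w 3) • wedge (e 3) (e 1)
      + (v 3 * w 2 - v 2 * w 3) • wedge (e 3) (e 2) := by
  conv_lhs => rw [eq_sum_e v, eq_sum_e w]
  simp only [wedge_add_left, wedge_add_right, wedge_smul_left, wedge_smul_right, wedge_self,
    smul_zero, add_zero, zero_add]
  rw [wedge_swap (e 0) (e 1), wedge_swap (e 0) (e 2), wedge_swap (e 0) (e 3),
    wedge_swap (e 1) (e 2), wedge_swap (e 3) (e 1), wedge_swap (e 3) (e 2)]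
  module

/-- The two-vectors `E_{i±}(e)` form a pseudo-orthonormal system. -/
theorem form2_E (s : ℝ) (hs : s * s = 1) (i j : Fin 3) :
    form2 (E s i e) (E s j e) = if i = j then ![-1, 1, 1] i else 0 := by
  have h2 : √2 ^ 2 = (2 : ℝ) := Real.sq_sqrt (by norm_num)
  fin_cases i <;> fin_cases j <;>
    simp [E, form2_wedge, form_apply, e] <;>
    field_simp <;> rw [h2, pow_two, hs] <;> norm_num

theorem form2_sum_E (s : ℝ) (hs : s * s = 1) (y y' : Fin 3 → ℝ) :
    form2 (∑ i, y i • E s i e) (∑ i, y' i • E s i e)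
      = -(y 0 * y' 0) + y 1 * y' 1 + y 2 * y' 2 := by
  simp only [Fin.sum_univ_three, map_add, map_smul, LinearMap.add_apply, LinearMap.smul_apply,
    form2_E s hs, smul_eq_mul]
  simp
  ring

theorem coords_sum_E (s : ℝ) (hs : s * s = 1) (y : Fin 3 → ℝ) :
    coords s (∑ i, y i • E s i e) = y := by
  ext i
  simp only [coords, Fin.sum_univ_three, map_add, map_smul, LinearMap.add_apply,
    LinearMap.smul_apply, form2_E s hs, smul_eq_mul]
  fin_cases i <;> simp

theorem hodgeStar_E (s : ℝ) (hs : s * s = 1) (i : Fin 3) :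
    hodgeStar (E s i e) = s • E s i e := by
  obtain ⟨h1, h2, h3, h4, h5, h6⟩ := hodgeStar_e
  have key : ∀ A B : TwoVec, hodgeStar A = B → hodgeStar B = A →
      hodgeStar ((1 / √2) • (A + s • B)) = s • (1 / √2) • (A + s • B) := by
    intro A B hA hB
    rw [map_smul, map_add, map_smul, hA, hB, smul_comm s, smul_add s, smul_smul s, hs, one_smul,
      add_comm]
  fin_cases i
  · exact key _ _ h1 h4
  · exact key _ _ h2 h5
  · exact key _ _ h3 h6

theorem sum_E_mem_selfDual (y : Fin 3 → ℝ) : ∑ i, y i • E 1 i e ∈ selfDual := by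
  simp [selfDual, map_sum, hodgeStar_E 1 (by norm_num)]

theorem sum_E_mem_antiSelfDual (y : Fin 3 → ℝ) : ∑ i, y i • E (-1) i e ∈ antiSelfDual := by
  simp [antiSelfDual, map_sum, hodgeStar_E (-1) (by norm_num)]

/-! ### Plücker coordinates of vectors of `ℂ⁴` -/

/-- The polarised Plücker coordinates of the two-vector `Re z ∧ Im z`. -/
def plucker (z w : C4) (j k : Fin 4) : ℝ := (z j).re * (w k).im - (z k).re * (w j).im

/-- The coordinates of the (anti-)self-dual part of `Re z ∧ Im w`. -/
def dualCoords (s : ℝ) (z w : C4) : Fin 3 → ℝ :=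
  ![plucker z w 0 1 + s * plucker z w 3 2, plucker z w 0 2 + s * plucker z w 3 1,
    plucker z w 0 3 + s * plucker z w 1 2]

/-- The (anti-)self-dual part of `Re z ∧ Im z`. -/
def dualPart (s : ℝ) (z : C4) : TwoVec := ∑ i, dualCoords s z z i • E s i e

theorem plucker_smul (a : ℂ) (z : C4) (j k : Fin 4) :
    plucker (a • z) (a • z) j k = Complex.normSq a * plucker z z j k := by
  simp [plucker, Complex.normSq_apply]
  ring

theorem dualPart_smul (s : ℝ) (a : ℂ) (z : C4) :
    dualPart s (a • z) = Complex.normSq a • dualPart s z := by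
  simp only [dualPart, Finset.smul_sum, smul_smul]
  refine Finset.sum_congr rfl fun i _ => ?_
  congr 1
  fin_cases i <;> simp [dualCoords, plucker_smul] <;> ring

/-! ### Pseudo-orthonormal bases -/

theorem det_diagonal_sgn : (Matrix.diagonal sgn).det = 1 := by
  simp [Matrix.det_diagonal, Fin.prod_univ_four, sgn]

theorem of_mul_diagonal_mul_transpose (u v : Fin 4 → R4) :
    Matrix.of u * (Matrix.diagonal sgn * (Matrix.of v).transpose)
      = Matrix.of fun i j => form (u i) (v j) := by
  ext i j
  simp [Matrix.mul_apply, Fin.sum_univ_four, form_apply, sgn, Matrix.diagonal]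
  ring

theorem det_mul_det_eq (u v : Fin 4 → R4) :
    (Matrix.of u).det * (Matrix.of v).det = (Matrix.of fun i j => form (u i) (v j)).det := by
  rw [← of_mul_diagonal_mul_transpose, Matrix.det_mul, Matrix.det_mul, det_diagonal_sgn,
    Matrix.det_transpose, one_mul]

theorem det_sq_eq_one {u : Fin 4 → R4}
    (h : ∀ i j, form (u i) (u j) = if i = j then sgn i else 0) :
    (Matrix.of u).det * (Matrix.of u).det = 1 := by
  rw [det_mul_det_eq, ← det_diagonal_sgn]
  congr 1
  ext i j
  simp [h, Matrix.diagonal]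

theorem IsPosPseudoOrthonormal.det_eq_one {u : Fin 4 → R4} (h : IsPosPseudoOrthonormal u) :
    (Matrix.of u).det = 1 := by
  have h1 := det_sq_eq_one h.1
  have h2 := h.2
  nlinarith

/-- Multiplying by `det u = 1` turns the determinant into that of the matrix of products with `u`;
its first two rows are `-1` on the diagonal and `0` elsewhere, so only the lower right 2×2 block
survives. -/
theorem IsPosPseudoOrthonormal.det_cons {u : Fin 4 → R4} (h : IsPosPseudoOrthonormal u)
    (x y : R4) :
    (Matrix.of ![u 0, u 1, x, y]).det
      = form x (u 2) * form y (u 3) - form x (u 3) * form y (u 2) := by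
  have h1 := det_mul_det_eq ![u 0, u 1, x, y] u
  rw [h.det_eq_one, mul_one] at h1
  rw [h1]
  have h2 := h.1
  simp [Matrix.det_succ_row_zero, Fin.sum_univ_succ, h2, sgn, Fin.succAbove]
  ring

/-- The complementary minors of a positively oriented pseudo-orthonormal basis: this says
`u₄ ∧ u₃ = ∗(u₁ ∧ u₂)`. -/
theorem IsPosPseudoOrthonormal.minors {u : Fin 4 → R4} (h : IsPosPseudoOrthonormal u) :
    u 3 0 * u 2 1 - u 3 1 * u 2 0 = u 0 3 * u 1 2 - u 0 2 * u 1 3 ∧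
    u 3 0 * u 2 2 - u 3 2 * u 2 0 = u 0 3 * u 1 1 - u 0 1 * u 1 3 ∧
    u 3 0 * u 2 3 - u 3 3 * u 2 0 = u 0 1 * u 1 2 - u 0 2 * u 1 1 ∧
    u 3 1 * u 2 2 - u 3 2 * u 2 1 = u 0 0 * u 1 3 - u 0 3 * u 1 0 ∧
    u 3 3 * u 2 1 - u 3 1 * u 2 3 = u 0 0 * u 1 2 - u 0 2 * u 1 0 ∧
    u 3 3 * u 2 2 - u 3 2 * u 2 3 = u 0 0 * u 1 1 - u 0 1 * u 1 0 := by
  -- For two standard basis vectors the left side is the complementary minor of `u₁, u₂` and the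
  -- right side is a minor of `u₃, u₄` with the signs of the metric.
  have h01 := h.det_cons (e 0) (e 1)
  have h02 := h.det_cons (e 0) (e 2)
  have h03 := h.det_cons (e 0) (e 3)
  have h12 := h.det_cons (e 1) (e 2)
  have h13 := h.det_cons (e 1) (e 3)
  have h23 := h.det_cons (e 2) (e 3)
  simp [Matrix.det_succ_row_zero, Fin.sum_univ_succ, Fin.succAbove, form_apply, e]
    at h01 h02 h03 h12 h13 h23
  refine ⟨?_, ?_, ?_, ?_, ?_, ?_⟩ <;> linarith

/-- Two orthonormal timelike vectors extend to a positively oriented pseudo-orthonormal basis. -/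
theorem exists_isPosPseudoOrthonormal (a b : R4) (ha : form a a = -1) (hb : form b b = -1)
    (hab : form a b = 0) : ∃ u, IsPosPseudoOrthonormal u ∧ u 0 = a ∧ u 1 = b := by
  have hba : form b a = 0 := by rw [← hab, form_apply, form_apply]; ring
  have hc : ∀ x y : R4, form x y = form y x := fun x y => by
    rw [form_apply, form_apply]; ring
  -- Projection of `e₃` off the span of `a` and `b`; the signs are plus because `a` and `b` have
  -- square `-1`.
  set p : R4 := e 2 + form (e 2) a • a + form (e 2) b • b with hp
  set q : R4 := e 3 + form (e 3) a • a + form (e 3) b • b with hq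
  set a2 := form (e 2) a
  set b2 := form (e 2) b
  set a3 := form (e 3) a
  set b3 := form (e 3) b
  have e22 : form (e 2) (e 2) = 1 := by simp [form_apply, e]
  have e33 : form (e 3) (e 3) = 1 := by simp [form_apply, e]
  have e23 : form (e 2) (e 3) = 0 := by simp [form_apply, e]
  have e32 : form (e 3) (e 2) = 0 := by simp [form_apply, e]
  have pa : form p a = 0 := by simp [hp, ha, hba, a2]
  have pb : form p b = 0 := by simp [hp, hb, hab, b2]
  have qa : form q a = 0 := by simp [hq, ha, hba, a3]
  have qb : form q b = 0 := by simp [hq, hb, hab, b3]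
  have pp : form p p = 1 + a2 ^ 2 + b2 ^ 2 := by
    simp [hp, ha, hb, hab, hba, e22, hc a (e 2), hc b (e 2), a2, b2]; ring
  have qq : form q q = 1 + a3 ^ 2 + b3 ^ 2 := by
    simp [hq, ha, hb, hab, hba, e33, hc a (e 3), hc b (e 3), a3, b3]; ring
  have pq : form p q = a2 * a3 + b2 * b3 := by
    simp [hp, hq, ha, hb, hab, hba, e23, hc a (e 3), hc b (e 3), a3, b3, a2, b2]; ring
  have ppos : 0 < form p p := by rw [pp]; positivity
  -- Gram–Schmidt with the denominator cleared.
  set r : R4 := form p p • q - form p q • p with hr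
  have ra : form r a = 0 := by simp [hr, pa, qa]
  have rb : form r b = 0 := by simp [hr, pb, qb]
  have rp : form r p = 0 := by simp [hr, hc q p]; ring
  have rr : form r r = form p p * (form p p * form q q - form p q ^ 2) := by
    simp [hr, hc q p]; ring
  have rpos : 0 < form r r := by
    rw [rr]
    refine mul_pos ppos ?_
    rw [pp, qq, pq]
    -- The Gram determinant of `p, q` equals `1 + a2² + b2² + a3² + b3² + (a2 b3 - a3 b2)²`.
    nlinarith [sq_nonneg (a2 * b3 - a3 * b2), sq_nonneg a2, sq_nonneg a3, sq_nonneg b2,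
      sq_nonneg b3]
  set c : R4 := (√(form p p))⁻¹ • p with hcdef
  set d : R4 := (√(form r r))⁻¹ • r with hddef
  have norm1 : ∀ x : R4, 0 < form x x →
      form ((√(form x x))⁻¹ • x) ((√(form x x))⁻¹ • x) = 1 := by
    intro x hx
    have := Real.mul_self_sqrt hx.le
    have h0 : √(form x x) ≠ 0 := (Real.sqrt_pos.2 hx).ne'
    simp only [map_smul, LinearMap.smul_apply, smul_eq_mul]
    field_simp
    rw [pow_two, this]
  have cc : form c c = 1 := norm1 p ppos
  have dd : form d d = 1 := norm1 r rpos
  have ca : form c a = 0 := by simp [hcdef, pa]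
  have cb : form c b = 0 := by simp [hcdef, pb]
  have da : form d a = 0 := by simp [hddef, ra]
  have db : form d b = 0 := by simp [hddef, rb]
  have dc : form d c = 0 := by simp [hddef, hcdef, rp]
  have key : ∀ t : ℝ, t * t = 1 → ∀ i j, form (![a, b, c, t • d] i) (![a, b, c, t • d] j)
      = if i = j then sgn i else 0 := by
    intro t ht i j
    fin_cases i <;> fin_cases j <;>
      simp [sgn, ha, hb, hab, hba, cc, dd, ca, cb, da, db, dc, ht, hc a c, hc b c, hc a d, hc b d,
        hc c d]
  -- If the orientation is wrong, the last spacelike vector is reversed; the determinant cannot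
  -- vanish because its square is `1`.
  rcases lt_or_ge 0 (Matrix.of ![a, b, c, d]).det with hdet | hdet
  · refine ⟨![a, b, c, d], ⟨?_, hdet⟩, rfl, rfl⟩
    simpa using key 1 (by norm_num)
  · refine ⟨![a, b, c, (-1 : ℝ) • d], ⟨key (-1) (by norm_num), ?_⟩, rfl, rfl⟩
    have h1 := det_sq_eq_one (key (-1) (by norm_num))
    have h2 : (Matrix.of ![a, b, c, (-1 : ℝ) • d]).det = -(Matrix.of ![a, b, c, d]).det := by
      simp [Matrix.det_succ_row_zero, Fin.sum_univ_succ, Fin.succAbove]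
      ring
    rw [h2] at h1 ⊢
    rcases hdet.lt_or_eq with h3 | h3
    · exact neg_pos.2 h3
    · simp [h3] at h1

/-! ### Adapted bases of oriented planes -/

theorem form_comm (v w : R4) : form v w = form w v := by
  rw [form_apply, form_apply]; ring

theorem exists_isAdaptedBasis (P : NegOrientedPlane) : ∃ u, IsAdaptedBasis P u := by
  obtain ⟨V, hV, hneg, o⟩ := P
  have : FiniteDimensional ℝ V := FiniteDimensional.of_finrank_pos (by omega)
  let b := Module.finBasisOfFinrankEq ℝ V hV
  have b0 : form (b 0 : R4) (b 0) < 0 := hneg _ (b 0).2 (by simpa using b.ne_zero 0)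
  set w : V := (-form (b 0 : R4) (b 0)) • b 1 + form (b 1 : R4) (b 0) • b 0 with hw
  have li : LinearIndependent ℝ ![b 0, b 1] := by
    have := b.linearIndependent
    convert this using 1
    ext i; fin_cases i <;> rfl
  have hw0 : w ≠ 0 := by
    intro h
    have := LinearIndependent.pair_iff.1 li (form (b 1 : R4) (b 0)) (-form (b 0 : R4) (b 0))
      (by rw [add_comm]; exact h)
    linarith [this.2]
  have ww : form (w : R4) w < 0 := hneg _ w.2 (by simpa using hw0)
  have wb : form (w : R4) (b 0) = 0 := by simp [hw]; ring
  set x : V := (√(-form (b 0 : R4) (b 0)))⁻¹ • b 0 with hx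
  set y : V := (√(-form (w : R4) w))⁻¹ • w with hy
  have norm1 : ∀ v : V, form (v : R4) v < 0 →
      form (((√(-form (v : R4) v))⁻¹ • v : V) : R4) ((√(-form (v : R4) v))⁻¹ • v : V) = -1 := by
    intro v hv
    have := Real.mul_self_sqrt (neg_pos.2 hv).le
    have h0 : √(-form (v : R4) v) ≠ 0 := (Real.sqrt_pos.2 (neg_pos.2 hv)).ne'
    simp only [Submodule.coe_smul, map_smul, LinearMap.smul_apply, smul_eq_mul]
    field_simp
    rw [pow_two, this, neg_neg]
  have xx : form (x : R4) x = -1 := norm1 _ b0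
  have yy : form (y : R4) y = -1 := norm1 _ ww
  have yx : form (y : R4) x = 0 := by simp [hx, hy, wb]
  have xy : form (x : R4) y = 0 := by rw [form_comm, yx]
  have li2 : LinearIndependent ℝ ![x, y] := by
    rw [LinearIndependent.pair_iff]
    intro s t hst
    have h1 : form ((s • x + t • y : V) : R4) x = 0 := by rw [hst]; simp
    have h2 : form ((s • x + t • y : V) : R4) y = 0 := by rw [hst]; simp
    simp [xx, yy, xy, yx] at h1 h2
    exact ⟨h1, h2⟩
  let B := basisOfLinearIndependentOfCardEqFinrank li2 (by simp [hV])
  have hB : ⇑B = ![x, y] := coe_basisOfLinearIndependentOfCardEqFinrank _ _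
  -- Correcting the orientation only changes signs of basis vectors, so orthonormality survives.
  let C := B.adjustToOrientation o
  have hC : C.orientation = o := B.orientation_adjustToOrientation o
  have c0 : C 0 = x ∨ C 0 = -x := by
    have := B.adjustToOrientation_apply_eq_or_eq_neg o 0
    rwa [hB] at this
  have c1 : C 1 = y ∨ C 1 = -y := by
    have := B.adjustToOrientation_apply_eq_or_eq_neg o 1
    rwa [hB] at this
  obtain ⟨u, hu, hu0, hu1⟩ := exists_isPosPseudoOrthonormal (C 0) (C 1)
    (by rcases c0 with h | h <;> simp [h, xx]) (by rcases c1 with h | h <;> simp [h, yy])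
    (by rcases c0 with h | h <;> rcases c1 with h' | h' <;> simp [h, h', xy])
  exact ⟨u, hu, C, hu0.symm, hu1.symm, hC⟩

/-! ### The vector `u₁ + i u₂` and the points of the quadric. -/

@[simp] theorem complexVec_re (u : Fin 4 → R4) (k : Fin 4) : (complexVec u k).re = u 0 k := by
  simp [complexVec]

@[simp] theorem complexVec_im (u : Fin 4 → R4) (k : Fin 4) : (complexVec u k).im = u 1 k := by
  simp [complexVec]

theorem IsPosPseudoOrthonormal.E_zero {u : Fin 4 → R4} (h : IsPosPseudoOrthonormal u) {s : ℝ}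
    (hs : s * s = 1) : E s 0 u = dualPart s (complexVec u) := by
  obtain ⟨m1, m2, m3, m4, m5, m6⟩ := h.minors
  simp only [dualPart, Fin.sum_univ_three, dualCoords, plucker, E, complexVec_re, complexVec_im,
    Matrix.cons_val_zero, Matrix.cons_val_one, Matrix.cons_val]
  rw [wedge_eq_sum (u 0), wedge_eq_sum (u 3), m1, m2, m3, m4, m5, m6]
  match_scalars
  · ring
  · ring
  · ring
  · linear_combination (-(1 / √2) * (u 0 1 * u 1 2 - u 0 2 * u 1 1)) * hs
  · linear_combination (-(1 / √2) * (u 0 3 * u 1 1 - u 0 1 * u 1 3)) * hs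
  · linear_combination (-(1 / √2) * (u 0 3 * u 1 2 - u 0 2 * u 1 3)) * hs

theorem herm_self_re (z : C4) : (herm z z).re
    = form (fun k => (z k).re) (fun k => (z k).re) + form (fun k => (z k).im) (fun k => (z k).im) := by
  simp [herm, form_apply]
  ring

theorem quad_self_re (z : C4) : (quad z z).re
    = form (fun k => (z k).re) (fun k => (z k).re) - form (fun k => (z k).im) (fun k => (z k).im) := by
  simp [quad, form_apply]
  ring

theorem quad_self_im (z : C4) : (quad z z).im
    = 2 * form (fun k => (z k).re) (fun k => (z k).im) := by
  simp [quad, form_apply]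
  ring

theorem quad_smul_smul (a : ℂ) (z : C4) : quad (a • z) (a • z) = a ^ 2 * quad z z := by
  simp [quad]
  ring

theorem IsPosPseudoOrthonormal.herm_complexVec {u : Fin 4 → R4} (h : IsPosPseudoOrthonormal u) :
    (herm (complexVec u) (complexVec u)).re = -2 := by
  have h0 : form (u 0) (u 0) = -1 := by simp [h.1, sgn]
  have h1 : form (u 1) (u 1) = -1 := by simp [h.1, sgn]
  rw [herm_self_re]
  simp only [complexVec_re, complexVec_im]
  rw [h0, h1]; norm_num

theorem IsPosPseudoOrthonormal.quad_complexVec {u : Fin 4 → R4} (h : IsPosPseudoOrthonormal u) :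
    quad (complexVec u) (complexVec u) = 0 := by
  have h0 : form (u 0) (u 0) = -1 := by simp [h.1, sgn]
  have h1 : form (u 1) (u 1) = -1 := by simp [h.1, sgn]
  have h2 : form (u 0) (u 1) = 0 := by simp [h.1]
  apply Complex.ext
  · rw [quad_self_re]
    simp only [complexVec_re, complexVec_im]
    rw [h0, h1]; simp
  · rw [quad_self_im]
    simp only [complexVec_re, complexVec_im]
    rw [h2]; simp

theorem ne_zero_of_herm_neg {z : C4} (hz : (herm z z).re < 0) : z ≠ 0 := by
  rintro rfl
  simp [herm] at hz

theorem mk_mem_quadric {z : C4} (hz : (herm z z).re < 0) (hq : quad z z = 0) :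
    Projectivization.mk ℂ z (ne_zero_of_herm_neg hz) ∈ quadric := by
  constructor
  · intro w hw hw0
    rw [Projectivization.submodule_mk, Submodule.mem_span_singleton] at hw
    obtain ⟨a, rfl⟩ := hw
    have ha : a ≠ 0 := by rintro rfl; simp at hw0
    rw [herm_smul_smul, Complex.re_ofReal_mul]
    exact mul_neg_of_pos_of_neg (Complex.normSq_pos.2 ha) hz
  · intro w hw
    rw [Projectivization.submodule_mk, Submodule.mem_span_singleton] at hw
    obtain ⟨a, rfl⟩ := hw
    rw [quad_smul_smul, hq, mul_zero]

theorem IsPosPseudoOrthonormal.normSq_eq_one {u v : Fin 4 → R4} (hu : IsPosPseudoOrthonormal u)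
    (hv : IsPosPseudoOrthonormal v) {a : ℂ} (h : complexVec v = a • complexVec u) :
    Complex.normSq a = 1 := by
  have h1 := hv.herm_complexVec
  rw [h, herm_smul_smul, Complex.re_ofReal_mul, hu.herm_complexVec] at h1
  linarith

/-- Two adapted bases of the same plane differ by a rotation of the plane, and a rotation multiplies
`u₁ + i u₂` by a phase. -/
theorem exists_complexVec_eq_smul {P : NegOrientedPlane} {u v : Fin 4 → R4}
    (hu : IsAdaptedBasis P u) (hv : IsAdaptedBasis P v) :
    ∃ a : ℂ, complexVec v = a • complexVec u := by
  obtain ⟨hu, b, b0, b1, hb⟩ := hu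
  obtain ⟨hv, d, d0, d1, hd⟩ := hv
  have hdet : 0 < b.det d := (b.orientation_eq_iff_det_pos d).1 (hb.trans hd.symm)
  rw [Module.Basis.det_apply, Matrix.det_fin_two] at hdet
  simp only [Module.Basis.toMatrix_apply] at hdet
  have v0 : v 0 = b.repr (d 0) 0 • u 0 + b.repr (d 0) 1 • u 1 := by
    rw [← d0, ← b0, ← b1]
    have h := congrArg Subtype.val (b.sum_repr (d 0))
    rw [Fin.sum_univ_two] at h
    exact h.symm
  have v1 : v 1 = b.repr (d 1) 0 • u 0 + b.repr (d 1) 1 • u 1 := by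
    rw [← d1, ← b0, ← b1]
    have h := congrArg Subtype.val (b.sum_repr (d 1))
    rw [Fin.sum_univ_two] at h
    exact h.symm
  set α := b.repr (d 0) 0
  set β := b.repr (d 0) 1
  set γ := b.repr (d 1) 0
  set δ := b.repr (d 1) 1
  have h00 : form (v 0) (v 0) = -1 := by simp [hv.1, sgn]
  have h11 : form (v 1) (v 1) = -1 := by simp [hv.1, sgn]
  have h01 : form (v 0) (v 1) = 0 := by simp [hv.1]
  rw [v0] at h00 h01
  rw [v1] at h11 h01
  simp [hu.1, sgn] at h00 h11 h01
  -- Lagrange's identity: the squared determinant is the product of the squared row lengths minus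
  -- the square of their scalar product.
  have e1 : (α * δ - γ * β) * (α * δ - γ * β) = 1 := by
    have A : α * α + β * β = 1 := by linarith
    have B : γ * γ + δ * δ = 1 := by linarith
    have C : α * γ + β * δ = 0 := by linarith
    linear_combination A * (γ * γ + δ * δ) + B - (α * γ + β * δ) * C
  have e2 : α * δ - γ * β = 1 := by nlinarith
  -- `(δ - α)² + (γ + β)²` is the sum of the squared row lengths minus twice the determinant, that
  -- is `2 - 2 = 0`.
  have hδ : δ = α := by nlinarith [sq_nonneg (δ - α), sq_nonneg (γ + β)]
  have hγ : γ = -β := by nlinarith [sq_nonneg (δ - α), sq_nonneg (γ + β)]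
  refine ⟨⟨α, -β⟩, ?_⟩
  ext k
  apply Complex.ext
  · simp [v0]
  · simp [v1, hδ, hγ]; ring

/-- Conversely, a phase rotates within the plane and keeps its orientation. This is what makes
`planeLine` injective. -/
theorem isAdaptedBasis_of_complexVec_eq {P : NegOrientedPlane} {u v : Fin 4 → R4}
    (hu : IsAdaptedBasis P u) (hv : IsPosPseudoOrthonormal v) {a : ℂ}
    (h : complexVec v = a • complexVec u) : IsAdaptedBasis P v := by
  have ha := hu.1.normSq_eq_one hv h
  obtain ⟨hu, b, b0, b1, hb⟩ := hu
  rw [Complex.normSq_apply] at ha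
  have v0 : v 0 = a.re • u 0 - a.im • u 1 := by
    ext k
    have := congrArg Complex.re (congrFun h k)
    simpa using this
  have v1 : v 1 = a.im • u 0 + a.re • u 1 := by
    ext k
    have := congrArg Complex.im (congrFun h k)
    simp at this
    simp [this]; ring
  set d : Fin 2 → P.plane := ![a.re • b 0 - a.im • b 1, a.im • b 0 + a.re • b 1] with hd
  have hdet : b.det d = 1 := by
    rw [Module.Basis.det_apply, Matrix.det_fin_two]
    simp [Module.Basis.toMatrix_apply, hd]
    linarith
  obtain ⟨li, sp⟩ := (b.is_basis_iff_det (v := d)).2 (by rw [hdet]; exact isUnit_one)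
  refine ⟨hv, Module.Basis.mk li sp.ge, ?_, ?_, ?_⟩
  · simp [hd, v0, b0, b1]
  · simp [hd, v1, b0, b1]
  · rw [← hb]
    refine ((b.orientation_eq_iff_det_pos _).2 ?_).symm
    rw [Module.Basis.coe_mk, hdet]
    exact one_pos

theorem plane_eq_span {P : NegOrientedPlane} {u : Fin 4 → R4} (hu : IsAdaptedBasis P u) :
    P.plane = Submodule.span ℝ {u 0, u 1} := by
  obtain ⟨-, b, b0, b1, -⟩ := hu
  have := congrArg (Submodule.map P.plane.subtype) b.span_eq
  rw [Submodule.map_span, Submodule.map_top, Submodule.range_subtype] at this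
  rw [← this]
  congr 1
  ext x
  simp [b0, b1, Fin.exists_fin_two, eq_comm]

theorem eq_of_isAdaptedBasis {P Q : NegOrientedPlane} {u : Fin 4 → R4}
    (hP : IsAdaptedBasis P u) (hQ : IsAdaptedBasis Q u) : P = Q := by
  have h := (plane_eq_span hP).trans (plane_eq_span hQ).symm
  obtain ⟨V, hV, nV, oV⟩ := P
  obtain ⟨W, hW, nW, oW⟩ := Q
  obtain rfl : V = W := h
  obtain ⟨-, b, b0, b1, hb⟩ := hP
  obtain ⟨-, d, d0, d1, hd⟩ := hQ
  have : b = d := by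
    apply Module.Basis.eq_of_apply_eq
    intro i
    fin_cases i
    · exact Subtype.ext (b0.trans d0.symm)
    · exact Subtype.ext (b1.trans d1.symm)
  subst this
  congr 1
  exact hb.symm.trans hd

theorem exists_plane_of_isPosPseudoOrthonormal {u : Fin 4 → R4} (hu : IsPosPseudoOrthonormal u) :
    ∃ P, IsAdaptedBasis P u := by
  have li : LinearIndependent ℝ ![u 0, u 1] := by
    rw [LinearIndependent.pair_iff]
    intro s t hst
    have h1 : form (s • u 0 + t • u 1) (u 0) = 0 := by rw [hst]; simp
    have h2 : form (s • u 0 + t • u 1) (u 1) = 0 := by rw [hst]; simp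
    simp [hu.1, sgn] at h1 h2
    exact ⟨h1, h2⟩
  let b := Module.Basis.span li
  refine ⟨⟨Submodule.span ℝ (Set.range ![u 0, u 1]), ?_, ?_, b.orientation⟩, hu, b, ?_, ?_, rfl⟩
  · rw [Module.finrank_eq_card_basis b]; simp
  · intro v hv hv0
    rw [Matrix.range_cons_cons_empty, Submodule.mem_span_pair] at hv
    obtain ⟨s, t, rfl⟩ := hv
    simp [hu.1, sgn]
    rcases eq_or_ne s 0 with rfl | hs
    · rcases eq_or_ne t 0 with rfl | ht
      · simp at hv0
      · have := mul_self_pos.2 ht; linarith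
    · nlinarith [mul_self_pos.2 hs, mul_self_nonneg t]
  · exact Module.Basis.coe_span_apply li 0
  · exact Module.Basis.coe_span_apply li 1

/-- The quadric equation makes `Re z` and `Im z` orthogonal of equal norm, and the value `-2` makes
that norm `-1`. -/
theorem exists_complexVec_eq {z : C4} (hz : (herm z z).re = -2) (hq : quad z z = 0) :
    ∃ u, IsPosPseudoOrthonormal u ∧ complexVec u = z := by
  have h1 := quad_self_re z
  have h2 := quad_self_im z
  rw [hq] at h1 h2
  rw [herm_self_re] at hz
  simp only [Complex.zero_re, Complex.zero_im] at h1 h2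
  obtain ⟨u, hu, hu0, hu1⟩ := exists_isPosPseudoOrthonormal (fun k => (z k).re)
    (fun k => (z k).im) (by linarith) (by linarith) (by linarith)
  refine ⟨u, hu, ?_⟩
  ext k
  apply Complex.ext
  · simp [hu0]
  · simp [hu1]

/-! ### The bijection of oriented planes with the quadric, and the map on planes. -/

/-- A chosen adapted basis of an oriented plane. -/
def adaptedBasis (P : NegOrientedPlane) : Fin 4 → R4 := (exists_isAdaptedBasis P).choose

theorem adaptedBasis_spec (P : NegOrientedPlane) : IsAdaptedBasis P (adaptedBasis P) :=
  (exists_isAdaptedBasis P).choose_spec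

theorem herm_complexVec_neg (P : NegOrientedPlane) :
    (herm (complexVec (adaptedBasis P)) (complexVec (adaptedBasis P))).re < 0 := by
  rw [(adaptedBasis_spec P).1.herm_complexVec]; norm_num

/-- The point `[u₁ + i u₂]` of the quadric given by an oriented plane. -/
def planeLine (P : NegOrientedPlane) : quadric :=
  ⟨Projectivization.mk ℂ (complexVec (adaptedBasis P)) (ne_zero_of_herm_neg (herm_complexVec_neg P)),
    mk_mem_quadric (herm_complexVec_neg P) (adaptedBasis_spec P).1.quad_complexVec⟩

theorem planeLine_submodule {P : NegOrientedPlane} {u : Fin 4 → R4} (hu : IsAdaptedBasis P u) :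
    (planeLine P).1.submodule = Submodule.span ℂ {complexVec u} := by
  rw [planeLine, Projectivization.submodule_mk]
  obtain ⟨a, ha⟩ := exists_complexVec_eq_smul hu (adaptedBasis_spec P)
  have ha1 := hu.1.normSq_eq_one (adaptedBasis_spec P).1 ha
  have : a ≠ 0 := by rintro rfl; simp at ha1
  rw [ha, Submodule.span_singleton_smul_eq (IsUnit.mk0 a this)]

theorem planeLine_bijective : Function.Bijective planeLine := by
  constructor
  · intro P Q h
    have h1 := planeLine_submodule (adaptedBasis_spec P)
    rw [h, planeLine_submodule (adaptedBasis_spec Q)] at h1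
    have h2 : complexVec (adaptedBasis Q) ∈ Submodule.span ℂ {complexVec (adaptedBasis P)} := by
      rw [← h1]; exact Submodule.mem_span_singleton_self _
    obtain ⟨a, ha⟩ := Submodule.mem_span_singleton.1 h2
    exact eq_of_isAdaptedBasis (isAdaptedBasis_of_complexVec_eq (adaptedBasis_spec P)
      (adaptedBasis_spec Q).1 ha.symm) (adaptedBasis_spec Q)
  · rintro ⟨ℓ, hℓ⟩
    have hr : ℓ.rep ∈ ℓ.submodule := by
      rw [ℓ.submodule_eq]; exact Submodule.mem_span_singleton_self _
    have hneg := hℓ.1 _ hr ℓ.rep_nonzero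
    have hq := hℓ.2 _ hr
    -- The scaling that brings the Hermitian square of the representative to `-2`.
    set t : ℝ := √(2 / -(herm ℓ.rep ℓ.rep).re) with ht
    have htt : t * t = 2 / -(herm ℓ.rep ℓ.rep).re :=
      Real.mul_self_sqrt (div_nonneg (by norm_num) (neg_pos.2 hneg).le)
    have ht0 : (t : ℂ) ≠ 0 := by
      rw [Ne, Complex.ofReal_eq_zero]
      exact (Real.sqrt_pos.2 (div_pos (by norm_num) (neg_pos.2 hneg))).ne'
    obtain ⟨u, hu, huz⟩ := exists_complexVec_eq (z := (t : ℂ) • ℓ.rep)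
      (by
        rw [herm_smul_smul, Complex.re_ofReal_mul, Complex.normSq_ofReal, htt]
        field_simp [hneg.ne])
      (by rw [quad_smul_smul, hq, mul_zero])
    obtain ⟨P, hP⟩ := exists_plane_of_isPosPseudoOrthonormal hu
    refine ⟨P, Subtype.ext (Projectivization.submodule_injective ?_)⟩
    rw [planeLine_submodule hP, huz, Submodule.span_singleton_smul_eq (IsUnit.mk0 _ ht0),
      ← ℓ.submodule_eq]

/-- The identification of oriented planes with the points of the quadric. -/
def planeEquiv : NegOrientedPlane ≃ quadric := Equiv.ofBijective planeLine planeLine_bijective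

/-- The map `P ↦ (½ E₁₊(u_P), ½ E₁₋(u_P))`. -/
def planeMap (P : NegOrientedPlane) : TwoVec × TwoVec :=
  ((1 / 2 : ℝ) • E 1 0 (adaptedBasis P), (1 / 2 : ℝ) • E (-1) 0 (adaptedBasis P))

theorem E_zero_eq_of_isAdaptedBasis {P : NegOrientedPlane} {u v : Fin 4 → R4}
    (hu : IsAdaptedBasis P u) (hv : IsAdaptedBasis P v) {s : ℝ} (hs : s * s = 1) :
    E s 0 u = E s 0 v := by
  obtain ⟨a, ha⟩ := exists_complexVec_eq_smul hv hu
  rw [hu.1.E_zero hs, hv.1.E_zero hs, ha, dualPart_smul, hv.1.normSq_eq_one hu.1 ha, one_smul]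

theorem planeMap_eq {P : NegOrientedPlane} {u : Fin 4 → R4} (hu : IsAdaptedBasis P u) :
    planeMap P = ((1 / 2 : ℝ) • E 1 0 u, (1 / 2 : ℝ) • E (-1) 0 u) := by
  rw [planeMap, E_zero_eq_of_isAdaptedBasis (adaptedBasis_spec P) hu (by norm_num),
    E_zero_eq_of_isAdaptedBasis (adaptedBasis_spec P) hu (by norm_num)]

theorem planeMap_mem (P : NegOrientedPlane) :
    (planeMap P).1 ∈ selfDual ∧ (planeMap P).2 ∈ antiSelfDual := by
  have hu := (adaptedBasis_spec P).1
  rw [planeMap, hu.E_zero (by norm_num), hu.E_zero (by norm_num)]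
  exact ⟨selfDual.smul_mem _ (sum_E_mem_selfDual _),
    antiSelfDual.smul_mem _ (sum_E_mem_antiSelfDual _)⟩

/-- The map to the two-vectors at a unit vector over the quadric. -/
def dualParts (z : C4) : TwoVec × TwoVec := (dualPart 1 z, dualPart (-1) z)

/-- Passing from Hermitian square `-2` to `-1` multiplies the two-vector by `½`, so on Hopf lifts
`φ` needs no extra factor. -/
theorem planeMap_planeEquiv_symm (ℓ : quadric) {z : C4} (hz : z ∈ ℓ.1.submodule) (hz1 : z ∈ H73) :
    planeMap (planeEquiv.symm ℓ) = dualParts z := by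
  set P := planeEquiv.symm ℓ with hP
  have hℓ : planeLine P = ℓ := planeEquiv.apply_symm_apply ℓ
  have hu := adaptedBasis_spec P
  rw [← hℓ, planeLine_submodule hu] at hz
  obtain ⟨a, rfl⟩ := Submodule.mem_span_singleton.1 hz
  have ha : Complex.normSq a = 1 / 2 := by
    have h : (herm _ _).re = -1 := hz1
    rw [herm_smul_smul, Complex.re_ofReal_mul, hu.1.herm_complexVec] at h
    linarith
  rw [planeMap, hu.1.E_zero (by norm_num), hu.1.E_zero (by norm_num), dualParts, dualPart_smul,
    dualPart_smul, ha]

/-! ### The section of the Hopf fibration over the quadric -/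

theorem unit_quadric_eqs {z : C4} (hz : z ∈ H73) (hq : quad z z = 0) :
    (-((z 0).re ^ 2) - (z 1).re ^ 2 + (z 2).re ^ 2 + (z 3).re ^ 2 = -1 / 2) ∧
    (-((z 0).im ^ 2) - (z 1).im ^ 2 + (z 2).im ^ 2 + (z 3).im ^ 2 = -1 / 2) ∧
    (-((z 0).re * (z 0).im) - (z 1).re * (z 1).im + (z 2).re * (z 2).im
      + (z 3).re * (z 3).im = 0) := by
  have h0 : (herm z z).re = -1 := hz
  have h1 := quad_self_re z
  have h2 := quad_self_im z
  rw [herm_self_re] at h0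
  rw [hq] at h1 h2
  simp only [Complex.zero_re, Complex.zero_im, form_apply] at h0 h1 h2
  refine ⟨?_, ?_, ?_⟩ <;> linarith

/-- By Lagrange's identity the two squares are `(½ + a)(½ + b) - c²` and `ab - c²` with `a, b ≥ 0`,
and their difference is `¼ + (a + b)/2`. Hence the coordinate `p₁₂` never vanishes on the quadric.
-/
theorem plucker_sq_ge {z : C4} (hz : z ∈ H73) (hq : quad z z = 0) :
    plucker z z 3 2 ^ 2 + 1 / 4 ≤ plucker z z 0 1 ^ 2 := by
  obtain ⟨h1, h2, h3⟩ := unit_quadric_eqs hz hq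
  simp only [plucker]
  set a := (z 2).re ^ 2 + (z 3).re ^ 2 with ha
  set b := (z 2).im ^ 2 + (z 3).im ^ 2 with hb
  have ea : (z 0).re ^ 2 + (z 1).re ^ 2 = 1 / 2 + a := by linarith
  have eb : (z 0).im ^ 2 + (z 1).im ^ 2 = 1 / 2 + b := by linarith
  have ec : (z 0).re * (z 0).im + (z 1).re * (z 1).im
      = (z 2).re * (z 2).im + (z 3).re * (z 3).im := by linarith
  have ha0 : 0 ≤ a := by positivity
  have hb0 : 0 ≤ b := by positivity
  have e1 : ((z 0).re * (z 1).im - (z 1).re * (z 0).im) ^ 2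
      = (1 / 2 + a) * (1 / 2 + b) - ((z 2).re * (z 2).im + (z 3).re * (z 3).im) ^ 2 := by
    rw [← ea, ← eb, ← ec]; ring
  have e2 : ((z 3).re * (z 2).im - (z 2).re * (z 3).im) ^ 2
      = a * b - ((z 2).re * (z 2).im + (z 3).re * (z 3).im) ^ 2 := by
    rw [ha, hb]; ring
  rw [e1, e2]
  nlinarith

/-- The coordinates of the (anti-)self-dual part lie on the hyperboloid. -/
theorem dualCoords_hyperboloid {s : ℝ} (hs : s * s = 1) {z : C4} (hz : z ∈ H73)
    (hq : quad z z = 0) :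
    -(dualCoords s z z 0) ^ 2 + dualCoords s z z 1 ^ 2 + dualCoords s z z 2 ^ 2 = -1 / 4 := by
  obtain ⟨h1, h2, h3⟩ := unit_quadric_eqs hz hq
  have hs2 : s ^ 2 = 1 := by rw [pow_two, hs]
  -- Cauchy–Binet: the left side is the square of `Re z ∧ Im z`, hence minus the Gram determinant `½
  -- · ½`.
  have cb : -(plucker z z 0 1) ^ 2 + plucker z z 0 2 ^ 2 + plucker z z 0 3 ^ 2
      - plucker z z 3 2 ^ 2 + plucker z z 3 1 ^ 2 + plucker z z 1 2 ^ 2 = -1 / 4 := by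
    simp only [plucker]
    linear_combination (-(-((z 0).im ^ 2) - (z 1).im ^ 2 + (z 2).im ^ 2 + (z 3).im ^ 2)) * h1
      + 1 / 2 * h2 + (-((z 0).re * (z 0).im) - (z 1).re * (z 1).im + (z 2).re * (z 2).im
      + (z 3).re * (z 3).im) * h3
  -- The Plücker relation, which removes the cross term linear in `s`.
  have pl : -(plucker z z 0 1 * plucker z z 3 2) + plucker z z 0 2 * plucker z z 3 1
      + plucker z z 0 3 * plucker z z 1 2 = 0 := by
    simp only [plucker]; ring
  simp only [dualCoords, Matrix.cons_val_zero, Matrix.cons_val_one, Matrix.cons_val]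
  linear_combination cb + 2 * s * pl
    + (-(plucker z z 3 2) ^ 2 + plucker z z 3 1 ^ 2 + plucker z z 1 2 ^ 2) * hs

/-- The real parts of `z₁̅ z` in terms of Plücker coordinates. -/
def secRe (a b : Fin 3 → ℝ) : Fin 4 → ℝ :=
  ![2 * (a 0 ^ 2 - a 1 ^ 2 - a 2 ^ 2), -2 * (a 1 * b 2 - a 2 * b 1),
    -2 * (a 0 * b 2 - a 2 * b 0), 2 * (a 0 * b 1 - a 1 * b 0)]

/-- The vector `z₁̅ z` in terms of the Plücker coordinates of `z`. -/
def secVec (a b : Fin 3 → ℝ) : C4 := fun j => ⟨secRe a b j, (![0, a 0, a 1, a 2] : Fin 4 → ℝ) j⟩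

/-- The imaginary part of `z̅₁ z_j` is the Plücker coordinate `p₁ⱼ` itself. The real part arises by
contracting `p₁ₖ pⱼₖ` over `k` with the metric, because `Re z` and `Im z` are orthogonal of square
`-½`. -/
theorem secVec_plucker {z : C4} (hz : z ∈ H73) (hq : quad z z = 0) :
    secVec ![plucker z z 0 1, plucker z z 0 2, plucker z z 0 3]
      ![plucker z z 3 2, plucker z z 3 1, plucker z z 1 2] = conj (z 0) • z := by
  obtain ⟨h1, h2, h3⟩ := unit_quadric_eqs hz hq
  have key : ∀ j : Fin 4, -2 * (-((z 0).re * (z 0).im - (z 0).re * (z 0).im) * plucker z z j 0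
      - plucker z z 0 1 * plucker z z j 1 + plucker z z 0 2 * plucker z z j 2
      + plucker z z 0 3 * plucker z z j 3) = (z 0).re * (z j).re + (z 0).im * (z j).im := by
    intro j
    simp only [plucker]
    linear_combination -2 * (z 0).im * (z j).im * h1 - 2 * (z 0).re * (z j).re * h2
      + 2 * ((z 0).re * (z j).im + (z 0).im * (z j).re) * h3
  ext j
  apply Complex.ext
  · simp only [Pi.smul_apply, smul_eq_mul, Complex.mul_re, Complex.conj_re, Complex.conj_im]
    rw [neg_mul, sub_neg_eq_add, ← key j]
    fin_cases j <;> simp [secVec, secRe, plucker] <;> ring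
  · fin_cases j <;> simp [secVec, plucker] <;> ring

/-- `h1` is the Plücker relation and `h2` the normalisation of the two-vector; under them `secRe a b
0` plays the role of `|z₁|²`, and `z̅₁ z` has Hermitian square `-|z₁|²`. -/
theorem herm_secVec {a b : Fin 3 → ℝ} (h1 : -(a 0 * b 0) + a 1 * b 1 + a 2 * b 2 = 0)
    (h2 : -(a 0) ^ 2 + a 1 ^ 2 + a 2 ^ 2 - b 0 ^ 2 + b 1 ^ 2 + b 2 ^ 2 = -1 / 4) :
    (herm (secVec a b) (secVec a b)).re = -secRe a b 0 := by
  simp [herm, secVec, secRe]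
  linear_combination 4 * (-(a 0 * b 0) + a 1 * b 1 + a 2 * b 2) * h1
    + 4 * (a 0 ^ 2 - a 1 ^ 2 - a 2 ^ 2) * h2

theorem quad_secVec {a b : Fin 3 → ℝ} (h1 : -(a 0 * b 0) + a 1 * b 1 + a 2 * b 2 = 0)
    (h2 : -(a 0) ^ 2 + a 1 ^ 2 + a 2 ^ 2 - b 0 ^ 2 + b 1 ^ 2 + b 2 ^ 2 = -1 / 4) :
    quad (secVec a b) (secVec a b) = 0 := by
  apply Complex.ext
  · simp [quad, secVec, secRe]
    linear_combination 4 * (-(a 0 * b 0) + a 1 * b 1 + a 2 * b 2) * h1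
      + 4 * (a 0 ^ 2 - a 1 ^ 2 - a 2 ^ 2) * h2
  · simp [quad, secVec, secRe]
    ring

theorem dualCoords_secVec {a b : Fin 3 → ℝ} (h1 : -(a 0 * b 0) + a 1 * b 1 + a 2 * b 2 = 0)
    (s : ℝ) : dualCoords s (secVec a b) (secVec a b) = secRe a b 0 • (a + s • b) := by
  ext i
  fin_cases i <;> simp [dualCoords, plucker, secVec, secRe]
  · linear_combination 2 * s * a 0 * h1
  · linear_combination 2 * s * a 1 * h1
  · linear_combination 2 * s * a 2 * h1

/-- A point of the hyperboloid. -/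
def IsHyp (y : Fin 3 → ℝ) : Prop := -(y 0) ^ 2 + y 1 ^ 2 + y 2 ^ 2 = -1 / 4 ∧ 0 < y 0

/-- The squared modulus of the first coordinate of the section. -/
def secNorm (p : (Fin 3 → ℝ) × (Fin 3 → ℝ)) : ℝ :=
  secRe ((1 / 2 : ℝ) • (p.1 + p.2)) ((1 / 2 : ℝ) • (p.1 - p.2)) 0

/-- A section of the Hopf fibration over the quadric, in hyperbolic coordinates. -/
def hopfSection (p : (Fin 3 → ℝ) × (Fin 3 → ℝ)) : C4 :=
  ((1 / √(secNorm p) : ℝ) : ℂ) •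
    secVec ((1 / 2 : ℝ) • (p.1 + p.2)) ((1 / 2 : ℝ) • (p.1 - p.2))

/-- The sum of two future timelike vectors is timelike, by the reversed Cauchy–Schwarz inequality.
-/
theorem secNorm_pos {y y' : Fin 3 → ℝ} (hy : IsHyp y) (hy' : IsHyp y') : 0 < secNorm (y, y') := by
  obtain ⟨h1, h0⟩ := hy
  obtain ⟨h1', h0'⟩ := hy'
  have key : y 1 * y' 1 + y 2 * y' 2 < y 0 * y' 0 := by
    refine lt_of_le_of_lt (le_abs_self _) (abs_lt_of_sq_lt_sq ?_ (mul_pos h0 h0').le)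
    nlinarith [sq_nonneg (y 1 * y' 2 - y 2 * y' 1), sq_nonneg (y 1), sq_nonneg (y 2),
      sq_nonneg (y' 1), sq_nonneg (y' 2)]
  simp [secNorm, secRe]
  nlinarith

/-- The Plücker relation for the two-vector with dual coordinates `y, y'` is the equality of their
Lorentzian squares: it holds because both hyperbolic planes have the same curvature. -/
theorem half_sum_rel {y y' : Fin 3 → ℝ} (hy : IsHyp y) (hy' : IsHyp y') :
    -(((1 / 2 : ℝ) • (y + y')) 0 * ((1 / 2 : ℝ) • (y - y')) 0)
      + ((1 / 2 : ℝ) • (y + y')) 1 * ((1 / 2 : ℝ) • (y - y')) 1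
      + ((1 / 2 : ℝ) • (y + y')) 2 * ((1 / 2 : ℝ) • (y - y')) 2 = 0 := by
  simp
  linear_combination (hy.1 - hy'.1) / 4

theorem half_sum_norm {y y' : Fin 3 → ℝ} (hy : IsHyp y) (hy' : IsHyp y') :
    -(((1 / 2 : ℝ) • (y + y')) 0) ^ 2 + (((1 / 2 : ℝ) • (y + y')) 1) ^ 2
      + (((1 / 2 : ℝ) • (y + y')) 2) ^ 2 - (((1 / 2 : ℝ) • (y - y')) 0) ^ 2
      + (((1 / 2 : ℝ) • (y - y')) 1) ^ 2 + (((1 / 2 : ℝ) • (y - y')) 2) ^ 2 = -1 / 4 := by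
  simp
  linear_combination (hy.1 + hy'.1) / 2

theorem normSq_inv_sqrt {r : ℝ} (hr : 0 < r) :
    Complex.normSq ((1 / √r : ℝ) : ℂ) = 1 / r := by
  rw [Complex.normSq_ofReal, div_mul_div_comm, Real.mul_self_sqrt hr.le, one_mul]

theorem hopfSection_mem_H73 {y y' : Fin 3 → ℝ} (hy : IsHyp y) (hy' : IsHyp y') :
    hopfSection (y, y') ∈ H73 := by
  have hr := secNorm_pos hy hy'
  change (herm _ _).re = -1
  rw [hopfSection, herm_smul_smul, Complex.re_ofReal_mul, normSq_inv_sqrt hr,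
    herm_secVec (half_sum_rel hy hy') (half_sum_norm hy hy')]
  change 1 / secNorm (y, y') * -secNorm (y, y') = -1
  field_simp

theorem quad_hopfSection {y y' : Fin 3 → ℝ} (hy : IsHyp y) (hy' : IsHyp y') :
    quad (hopfSection (y, y')) (hopfSection (y, y')) = 0 := by
  rw [hopfSection, quad_smul_smul, quad_secVec (half_sum_rel hy hy') (half_sum_norm hy hy'),
    mul_zero]

theorem dualCoords_smul (s : ℝ) (a : ℂ) (z : C4) :
    dualCoords s (a • z) (a • z) = Complex.normSq a • dualCoords s z z := by
  ext i
  fin_cases i <;> simp [dualCoords, plucker_smul] <;> ring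

theorem dualCoords_hopfSection {y y' : Fin 3 → ℝ} (hy : IsHyp y) (hy' : IsHyp y') (s : ℝ) :
    dualCoords s (hopfSection (y, y')) (hopfSection (y, y'))
      = (1 / 2 : ℝ) • (y + y') + s • (1 / 2 : ℝ) • (y - y') := by
  have hr := secNorm_pos hy hy'
  rw [hopfSection, dualCoords_smul, normSq_inv_sqrt hr, dualCoords_secVec (half_sum_rel hy hy'),
    smul_smul]
  change (1 / secNorm (y, y') * secNorm (y, y')) • _ = _
  rw [one_div_mul_cancel hr.ne', one_smul]

theorem dualCoords_one_hopfSection {y y' : Fin 3 → ℝ} (hy : IsHyp y) (hy' : IsHyp y') :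
    dualCoords 1 (hopfSection (y, y')) (hopfSection (y, y')) = y := by
  rw [dualCoords_hopfSection hy hy']
  module

theorem dualCoords_neg_one_hopfSection {y y' : Fin 3 → ℝ} (hy : IsHyp y) (hy' : IsHyp y') :
    dualCoords (-1) (hopfSection (y, y')) (hopfSection (y, y')) = y' := by
  rw [dualCoords_hopfSection hy hy']
  module

theorem plucker_hopfSection_pos {y y' : Fin 3 → ℝ} (hy : IsHyp y) (hy' : IsHyp y') :
    0 < plucker (hopfSection (y, y')) (hopfSection (y, y')) 0 1 := by
  have h1 := congrFun (dualCoords_one_hopfSection hy hy') 0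
  have h2 := congrFun (dualCoords_neg_one_hopfSection hy hy') 0
  simp [dualCoords] at h1 h2
  linarith [hy.2, hy'.2]

/-! ### The component of the quadric -/

/-- The points of the quadric whose oriented planes project to the first coordinate plane with
preserved orientation. -/
def posQuadric : Set (ℙ ℂ C4) :=
  {ℓ | ℓ ∈ quadric ∧ ∀ z ∈ ℓ.submodule, z ≠ 0 → 0 < plucker z z 0 1}

theorem rep_mem_submodule (ℓ : ℙ ℂ C4) : ℓ.rep ∈ ℓ.submodule := by
  rw [ℓ.submodule_eq]; exact Submodule.mem_span_singleton_self _

theorem submodule_eq_span {ℓ : ℙ ℂ C4} {z : C4} (hz0 : z ≠ 0) (hz : z ∈ ℓ.submodule) :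
    ℓ.submodule = Submodule.span ℂ {z} := by
  rw [ℓ.submodule_eq] at hz ⊢
  obtain ⟨a, rfl⟩ := Submodule.mem_span_singleton.1 hz
  have ha : a ≠ 0 := by rintro rfl; simp at hz0
  exact (Submodule.span_singleton_smul_eq (IsUnit.mk0 a ha) _).symm

theorem eq_of_mem_submodule {ℓ m : ℙ ℂ C4} {z : C4} (hz0 : z ≠ 0) (hz : z ∈ ℓ.submodule)
    (hz' : z ∈ m.submodule) : ℓ = m :=
  Projectivization.submodule_injective
    ((submodule_eq_span hz0 hz).trans (submodule_eq_span hz0 hz').symm)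

theorem plucker_pos_of_mem_submodule {ℓ : ℙ ℂ C4} {w z : C4} (hw : w ∈ ℓ.submodule)
    (hz : z ∈ ℓ.submodule) (hz0 : z ≠ 0) (hpos : 0 < plucker w w 0 1) : 0 < plucker z z 0 1 := by
  have hw0 : w ≠ 0 := by rintro rfl; simp [plucker] at hpos
  rw [submodule_eq_span hw0 hw] at hz
  obtain ⟨a, rfl⟩ := Submodule.mem_span_singleton.1 hz
  have ha : a ≠ 0 := by rintro rfl; simp at hz0
  rw [plucker_smul]
  exact mul_pos (Complex.normSq_pos.2 ha) hpos

theorem exists_mem_H73 {ℓ : ℙ ℂ C4} (hℓ : ℓ ∈ quadric) :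
    ∃ z ∈ ℓ.submodule, z ∈ H73 ∧ quad z z = 0 := by
  have hr := rep_mem_submodule ℓ
  have hneg := hℓ.1 _ hr ℓ.rep_nonzero
  have hz := ℓ.submodule.smul_mem ((1 / √(-(herm ℓ.rep ℓ.rep).re) : ℝ) : ℂ) hr
  refine ⟨_, hz, ?_, hℓ.2 _ hz⟩
  change (herm _ _).re = -1
  rw [herm_smul_smul, Complex.re_ofReal_mul, normSq_inv_sqrt (neg_pos.2 hneg)]
  field_simp [hneg.ne]

theorem hopfSection_hopf_mem {y y' : Fin 3 → ℝ} (hy : IsHyp y) (hy' : IsHyp y') :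
    hopf ⟨hopfSection (y, y'), hopfSection_mem_H73 hy hy'⟩ ∈ posQuadric := by
  refine ⟨mk_mem_quadric ?_ (quad_hopfSection hy hy'), ?_⟩
  · have h : (herm _ _).re = -1 := hopfSection_mem_H73 hy hy'
    rw [h]; norm_num
  · intro z hz hz0
    refine plucker_pos_of_mem_submodule ?_ hz hz0 (plucker_hopfSection_pos hy hy')
    rw [hopf, Projectivization.submodule_mk]
    exact Submodule.mem_span_singleton_self _

/-- On the positive part `plucker_sq_ge` gives `|p₄₃| < p₁₂`, so both leading coordinates `p₁₂ ±
p₄₃` are positive. -/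
theorem isHyp_dualCoords {s : ℝ} (hs : s * s = 1) {z : C4} (hz : z ∈ H73) (hq : quad z z = 0)
    (hpos : 0 < plucker z z 0 1) : IsHyp (dualCoords s z z) := by
  refine ⟨dualCoords_hyperboloid hs hz hq, ?_⟩
  have h := plucker_sq_ge hz hq
  simp only [dualCoords, Matrix.cons_val_zero]
  have h1 : (s * plucker z z 3 2) ^ 2 < plucker z z 0 1 ^ 2 := by
    rw [mul_pow, pow_two s, hs]; linarith
  have h2 := abs_lt_of_sq_lt_sq h1 hpos.le
  linarith [(abs_lt.1 h2).1]

/-- The section recovers a unit vector over the quadric up to the phase of its first entry. -/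
theorem conj_smul_eq {z : C4} (hz : z ∈ H73) (hq : quad z z = 0) :
    conj (z 0) • z = secVec ((1 / 2 : ℝ) • (dualCoords 1 z z + dualCoords (-1) z z))
      ((1 / 2 : ℝ) • (dualCoords 1 z z - dualCoords (-1) z z)) := by
  rw [← secVec_plucker hz hq]
  congr 1 <;> ext i <;> fin_cases i <;> simp [dualCoords] <;> ring

/-- Both dual parts together determine `z̅₁ z`, and `z₁ = 0` would contradict `plucker_sq_ge`. -/
theorem eq_smul_of_dualCoords_eq {z w : C4} (hz : z ∈ H73) (hq : quad z z = 0) (hw : w ∈ H73)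
    (hqw : quad w w = 0) (h1 : dualCoords 1 z z = dualCoords 1 w w)
    (h2 : dualCoords (-1) z z = dualCoords (-1) w w) : ∃ a : ℂ, a ≠ 0 ∧ z = a • w := by
  have h := conj_smul_eq hz hq
  rw [h1, h2, ← conj_smul_eq hw hqw] at h
  have ne : ∀ v : C4, v ∈ H73 → quad v v = 0 → conj (v 0) ≠ 0 := by
    intro v hv hqv h0
    have h0' : v 0 = 0 := by simpa using h0
    have := plucker_sq_ge hv hqv
    simp [plucker, h0'] at this
    nlinarith [sq_nonneg ((v 3).re * (v 2).im - (v 2).re * (v 3).im)]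
  refine ⟨(conj (z 0))⁻¹ * conj (w 0), mul_ne_zero (inv_ne_zero (ne z hz hq)) (ne w hw hqw), ?_⟩
  rw [mul_smul, ← h, smul_smul, inv_mul_cancel₀ (ne z hz hq), one_smul]

/-! ### Smoothness and connectedness -/

theorem contDiff_secNorm : ContDiff ℝ ∞ secNorm := by
  unfold secNorm
  simp [secRe]
  fun_prop

theorem contDiff_secVec : ContDiff ℝ ∞ (fun p : (Fin 3 → ℝ) × (Fin 3 → ℝ) =>
    secVec ((1 / 2 : ℝ) • (p.1 + p.2)) ((1 / 2 : ℝ) • (p.1 - p.2))) := by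
  rw [contDiff_pi]
  intro j
  have h : ∀ f g : (Fin 3 → ℝ) × (Fin 3 → ℝ) → ℝ, ContDiff ℝ ∞ f → ContDiff ℝ ∞ g →
      ContDiff ℝ ∞ (fun p => (⟨f p, g p⟩ : ℂ)) := fun f g hf hg =>
    Complex.equivRealProdCLM.symm.contDiff.comp (hf.prodMk hg)
  refine h _ _ ?_ ?_ <;> fin_cases j <;> simp [secRe] <;> fun_prop

theorem contDiffOn_hopfSection : ContDiffOn ℝ ∞ hopfSection {p | 0 < secNorm p} := by
  unfold hopfSection
  refine ContDiffOn.smul (Complex.ofRealCLM.contDiff.comp_contDiffOn ?_)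
    contDiff_secVec.contDiffOn
  refine contDiffOn_const.div (contDiff_secNorm.contDiffOn.sqrt fun p hp => hp.ne') ?_
  intro p hp
  exact (Real.sqrt_pos.2 hp).ne'

/-- The parametrisation of the hyperboloid by its last two coordinates. -/
def hypPoint (t : ℝ × ℝ) : Fin 3 → ℝ := ![√(1 / 4 + t.1 ^ 2 + t.2 ^ 2), t.1, t.2]

theorem isHyp_hypPoint (t : ℝ × ℝ) : IsHyp (hypPoint t) := by
  have h : 0 < 1 / 4 + t.1 ^ 2 + t.2 ^ 2 := by positivity
  refine ⟨?_, by simpa [hypPoint] using Real.sqrt_pos.2 h⟩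
  simp only [hypPoint, Matrix.cons_val_zero, Matrix.cons_val_one, Matrix.cons_val]
  rw [Real.sq_sqrt h.le]; ring

theorem IsHyp.eq_hypPoint {y : Fin 3 → ℝ} (hy : IsHyp y) : hypPoint (y 1, y 2) = y := by
  ext i
  fin_cases i <;> simp [hypPoint]
  rw [show (4 : ℝ)⁻¹ + y 1 ^ 2 + y 2 ^ 2 = y 0 ^ 2 by linarith [hy.1], Real.sqrt_sq hy.2.le]

theorem continuous_hypPoint : Continuous hypPoint := by
  refine continuous_pi fun i => ?_
  fin_cases i <;> simp [hypPoint] <;> fun_prop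

theorem continuous_projectivization_mk {X : Type*} [TopologicalSpace X] {g : X → C4}
    (hg : Continuous g) (h0 : ∀ x, g x ≠ 0) :
    Continuous (fun x => Projectivization.mk ℂ (g x) (h0 x)) := by
  have h1 : Continuous (fun x => (⟨g x, h0 x⟩ : {v : C4 // v ≠ 0})) := hg.subtype_mk h0
  exact (continuous_quotient_mk' (s := projectivizationSetoid ℂ C4)).comp h1

/-- The section, composed with the graph parametrisation of both hyperboloids, covers this set by a
continuous image of `ℝ² × ℝ²`. -/
theorem isPreconnected_posQuadric : IsPreconnected posQuadric := by
  let g : (ℝ × ℝ) × (ℝ × ℝ) → ℙ ℂ C4 := fun t =>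
    hopf ⟨_, hopfSection_mem_H73 (isHyp_hypPoint t.1) (isHyp_hypPoint t.2)⟩
  have hg : Continuous g := by
    refine continuous_projectivization_mk
      (g := fun t : (ℝ × ℝ) × (ℝ × ℝ) => hopfSection (hypPoint t.1, hypPoint t.2)) ?_ _
    refine contDiffOn_hopfSection.continuousOn.comp_continuous ?_ ?_
    · exact (continuous_hypPoint.comp continuous_fst).prodMk
        (continuous_hypPoint.comp continuous_snd)
    · exact fun t => secNorm_pos (isHyp_hypPoint _) (isHyp_hypPoint _)
  have : posQuadric = Set.range g := by
    apply Set.Subset.antisymm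
    · rintro ℓ ⟨hℓ, hpos⟩
      obtain ⟨z, hz, hz1, hzq⟩ := exists_mem_H73 hℓ
      have hp := hpos z hz (ne_zero_of_mem_H73 hz1)
      have y1 := isHyp_dualCoords (s := 1) (by norm_num) hz1 hzq hp
      have y2 := isHyp_dualCoords (s := -1) (by norm_num) hz1 hzq hp
      refine ⟨((dualCoords 1 z z 1, dualCoords 1 z z 2),
        (dualCoords (-1) z z 1, dualCoords (-1) z z 2)), ?_⟩
      simp only [g, y1.eq_hypPoint, y2.eq_hypPoint]
      obtain ⟨a, ha, h⟩ := eq_smul_of_dualCoords_eq (hopfSection_mem_H73 y1 y2)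
        (quad_hopfSection y1 y2) hz1 hzq (dualCoords_one_hopfSection y1 y2)
        (dualCoords_neg_one_hopfSection y1 y2)
      refine eq_of_mem_submodule (ne_zero_of_mem_H73 (hopfSection_mem_H73 y1 y2)) ?_
        (h ▸ ℓ.submodule.smul_mem a hz)
      rw [hopf, Projectivization.submodule_mk]
      exact Submodule.mem_span_singleton_self _
    · rintro _ ⟨t, rfl⟩
      exact hopfSection_hopf_mem (isHyp_hypPoint t.1) (isHyp_hypPoint t.2)
  rw [this]
  exact isPreconnected_range hg

theorem basePoint_mem_posQuadric : basePoint ∈ posQuadric := by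
  refine ⟨basePoint_mem_quadric, fun z hz hz0 => ?_⟩
  refine plucker_pos_of_mem_submodule (w := ![1, Complex.I, 0, 0]) ?_ hz hz0 ?_
  · rw [basePoint, Projectivization.submodule_mk]
    exact Submodule.mem_span_singleton_self _
  · simp [plucker]

/-- Rescaling multiplies the coordinate by `|a|² > 0`, so its sign does not depend on the
representative and openness can be tested on nonzero vectors. The values `t = ±1` serve for the two
signs. -/
theorem isOpen_rep_plucker (t : ℝ) : IsOpen {ℓ : ℙ ℂ C4 | 0 < t * plucker ℓ.rep ℓ.rep 0 1} := by
  have hc : Continuous (fun v : {v : C4 // v ≠ 0} => t * plucker v.1 v.1 0 1) := by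
    have hj : ∀ j, Continuous (fun v : {v : C4 // v ≠ 0} => v.1 j) := fun j =>
      (continuous_apply j).comp continuous_subtype_val
    have hre := fun j => Complex.continuous_re.comp (hj j)
    have him := fun j => Complex.continuous_im.comp (hj j)
    exact continuous_const.mul (((hre 0).mul (him 1)).sub ((hre 1).mul (him 0)))
  refine isOpen_coinduced.2 ?_
  convert isOpen_lt continuous_const hc using 1
  ext v
  change 0 < t * plucker (Projectivization.mk ℂ v.1 v.2).rep (Projectivization.mk ℂ v.1 v.2).rep 0 1
    ↔ 0 < t * plucker v.1 v.1 0 1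
  obtain ⟨a, ha⟩ := Projectivization.exists_smul_eq_mk_rep ℂ v.1 v.2
  rw [← ha, Units.smul_def, plucker_smul, mul_left_comm]
  exact mul_pos_iff_of_pos_left (Complex.normSq_pos.2 a.ne_zero)

/-- The two signs of the nowhere vanishing coordinate `p₁₂` give disjoint open sets covering the
quadric; the component of the base point stays in the positive one, which is itself connected. -/
theorem Q2star_eq : Q2star = posQuadric := by
  apply Set.Subset.antisymm
  · have hcover : Q2star ⊆ {ℓ : ℙ ℂ C4 | 0 < 1 * plucker ℓ.rep ℓ.rep 0 1}
        ∪ {ℓ : ℙ ℂ C4 | 0 < -1 * plucker ℓ.rep ℓ.rep 0 1} := by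
      intro ℓ hℓ
      have hq := Q2star_subset_quadric hℓ
      obtain ⟨z, hz, hz1, hzq⟩ := exists_mem_H73 hq
      have hne : plucker ℓ.rep ℓ.rep 0 1 ≠ 0 := by
        intro h0
        rw [ℓ.submodule_eq, Submodule.mem_span_singleton] at hz
        obtain ⟨a, rfl⟩ := hz
        have := plucker_sq_ge hz1 hzq
        rw [plucker_smul, plucker_smul, h0] at this
        nlinarith [sq_nonneg (Complex.normSq a * plucker ℓ.rep ℓ.rep 3 2)]
      rcases lt_or_gt_of_ne hne with h | h
      · right; simpa using h
      · left; simpa using h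
    have hsub := isPreconnected_connectedComponentIn.subset_left_of_subset_union
      (isOpen_rep_plucker 1) (isOpen_rep_plucker (-1))
      (Set.disjoint_left.2 fun ℓ h1 h2 => by
        simp only [Set.mem_ofPred_eq] at h1 h2; linarith) hcover
      ⟨basePoint, mem_connectedComponentIn basePoint_mem_quadric, by
        have := basePoint_mem_posQuadric.2 _ (rep_mem_submodule _) basePoint.rep_nonzero
        simpa using this⟩
    intro ℓ hℓ
    refine ⟨Q2star_subset_quadric hℓ, fun z hz hz0 =>
      plucker_pos_of_mem_submodule (rep_mem_submodule ℓ) hz hz0 ?_⟩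
    simpa using hsub hℓ
  · exact isPreconnected_posQuadric.subset_connectedComponentIn basePoint_mem_posQuadric
      fun ℓ hℓ => hℓ.1

/-! ### The differential, the metric and the complex structure -/

/-- The coordinates of the (anti-)self-dual part of `a ∧ b`. -/
def dualWedge (s : ℝ) (a b : R4) : Fin 3 → ℝ :=
  ![(a 0 * b 1 - a 1 * b 0) + s * (a 3 * b 2 - a 2 * b 3),
    (a 0 * b 2 - a 2 * b 0) + s * (a 3 * b 1 - a 1 * b 3),
    (a 0 * b 3 - a 3 * b 0) + s * (a 1 * b 2 - a 2 * b 1)]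

/-- The scalar product of `ℝ³₁`. -/
def lorentz (y y' : Fin 3 → ℝ) : ℝ := -(y 0 * y' 0) + y 1 * y' 1 + y 2 * y' 2

theorem lorentz_add_left (x y z : Fin 3 → ℝ) : lorentz (x + y) z = lorentz x z + lorentz y z := by
  simp [lorentz]; ring

theorem lorentz_add_right (x y z : Fin 3 → ℝ) : lorentz x (y + z) = lorentz x y + lorentz x z := by
  simp [lorentz]; ring

theorem cross_add_right (x y z : Fin 3 → ℝ) : cross x (y + z) = cross x y + cross x z := by
  ext i
  fin_cases i <;> simp [cross] <;> ring

/-- The Cauchy–Binet identity. -/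
theorem lorentz_dualWedge (a b c d : R4) :
    lorentz (dualWedge 1 a b) (dualWedge 1 c d) + lorentz (dualWedge (-1) a b) (dualWedge (-1) c d)
      = 2 * (-(form a c * form b d) + form a d * form c b) := by
  simp [lorentz, dualWedge, form_apply]
  ring

/-- The Lorentzian cross product is the Lie bracket of two-vectors. -/
theorem smul_cross_dualWedge {s : ℝ} (hs : s * s = 1) (a b c d : R4) :
    s • cross (dualWedge s a b) (dualWedge s c d)
      = form b c • dualWedge s a d - form b d • dualWedge s a c - form a c • dualWedge s b d
        + form a d • dualWedge s b c := by
  have hs2 : s ^ 2 = 1 := by rw [pow_two, hs]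
  have hs3 : s ^ 3 = s := by rw [pow_succ, hs2, one_mul]
  ext i
  fin_cases i <;> simp [cross, dualWedge, form_apply] <;> ring_nf <;> simp only [hs2, hs3] <;> ring

/-- The real parts of the entries. -/
def reVec (z : C4) : R4 := fun k => (z k).re

/-- The imaginary parts of the entries. -/
def imVec (z : C4) : R4 := fun k => (z k).im

theorem dualCoords_eq (s : ℝ) (z w : C4) : dualCoords s z w = dualWedge s (reVec z) (imVec w) := rfl

/-- The derivative at `z` of the coordinates of the (anti-)self-dual part of `Re z ∧ Im z`. -/
def polarCoords (s : ℝ) (z w : C4) : Fin 3 → ℝ := dualCoords s w z + dualCoords s z w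

theorem unit_form_eqs {z : C4} (hz : z ∈ H73) (hq : quad z z = 0) :
    form (reVec z) (reVec z) = -1 / 2 ∧ form (imVec z) (imVec z) = -1 / 2 ∧
      form (reVec z) (imVec z) = 0 := by
  obtain ⟨h1, h2, h3⟩ := unit_quadric_eqs hz hq
  simp only [form_apply, reVec, imVec]
  refine ⟨?_, ?_, ?_⟩ <;> linarith

theorem horizontal_form_eqs {z w : C4} (h : herm w z = 0) (hq : quad z w = 0) :
    form (reVec w) (reVec z) = 0 ∧ form (reVec w) (imVec z) = 0 ∧
      form (imVec w) (reVec z) = 0 ∧ form (imVec w) (imVec z) = 0 := by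
  have h1 := congrArg Complex.re h
  have h2 := congrArg Complex.im h
  have h3 := congrArg Complex.re hq
  have h4 := congrArg Complex.im hq
  simp [herm, quad] at h1 h2 h3 h4
  simp only [form_apply, reVec, imVec]
  refine ⟨?_, ?_, ?_, ?_⟩ <;> linarith

/-- After expansion by Cauchy–Binet, horizontality and tangency kill the mixed products, and the
squares `-½` of `Re z` and `Im z` cancel the factor `2`. -/
theorem lorentz_polarCoords {z w w' : C4} (hz : z ∈ H73) (hq : quad z z = 0)
    (hw : herm w z = 0) (hwq : quad z w = 0) (hw' : herm w' z = 0) (hwq' : quad z w' = 0) :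
    lorentz (polarCoords 1 z w) (polarCoords 1 z w')
      + lorentz (polarCoords (-1) z w) (polarCoords (-1) z w') = (herm w w').re := by
  obtain ⟨z1, z2, z3⟩ := unit_form_eqs hz hq
  obtain ⟨w1, w2, w3, w4⟩ := horizontal_form_eqs hw hwq
  obtain ⟨v1, v2, v3, v4⟩ := horizontal_form_eqs hw' hwq'
  have h : (herm w w').re = form (reVec w) (reVec w') + form (imVec w) (imVec w') := by
    simp [herm, form_apply, reVec, imVec]; ring
  have l1 := lorentz_dualWedge (reVec w) (imVec z) (reVec w') (imVec z)
  have l2 := lorentz_dualWedge (reVec w) (imVec z) (reVec z) (imVec w')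
  have l3 := lorentz_dualWedge (reVec z) (imVec w) (reVec w') (imVec z)
  have l4 := lorentz_dualWedge (reVec z) (imVec w) (reVec z) (imVec w')
  rw [z2, w2] at l1
  rw [w1, z3] at l2
  rw [z3, w4] at l3
  rw [z1, form_comm (reVec z) (imVec w), w3] at l4
  simp only [polarCoords, dualCoords_eq, lorentz_add_left, lorentz_add_right]
  rw [h]
  linarith

/-- The bracket with `Re z ∧ Im z` rotates the plane of `Re z, Im z` at rate `½` and kills its
orthogonal complement, where `Re w` and `Im w` lie. The `½` explains the factor `2`; the sign `s` is
the opposite complex structure on the second factor. -/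
theorem polarCoords_I_smul {s : ℝ} (hs : s * s = 1) {z w : C4} (hz : z ∈ H73) (hq : quad z z = 0)
    (hw : herm w z = 0) (hwq : quad z w = 0) :
    polarCoords s z (Complex.I • w)
      = (2 * s) • cross (dualCoords s z z) (polarCoords s z w) := by
  obtain ⟨z1, z2, z3⟩ := unit_form_eqs hz hq
  obtain ⟨w1, w2, w3, w4⟩ := horizontal_form_eqs hw hwq
  rw [mul_smul]
  simp only [polarCoords, dualCoords_eq, cross_add_right, smul_add s]
  rw [smul_cross_dualWedge hs, smul_cross_dualWedge hs, form_comm (imVec z) (reVec w),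
    form_comm (imVec z) (imVec w), form_comm (reVec z) (reVec w), form_comm (reVec z) (imVec w),
    form_comm (imVec z) (reVec z), z1, z2, z3, w1, w2, w3, w4]
  ext i
  fin_cases i <;> simp [dualWedge, reVec, imVec] <;> ring

theorem polarCoords_smul (s : ℝ) (a : ℂ) (z w : C4) :
    polarCoords s (a • z) (a • w) = Complex.normSq a • polarCoords s z w := by
  ext i
  fin_cases i <;> simp [polarCoords, dualCoords, plucker, Complex.normSq_apply] <;> ring

/-- The derivative at `z` of the pair of (anti-)self-dual parts of `Re z ∧ Im z`. -/
def polarParts (z : C4) : C4 →ₗ[ℝ] TwoVec × TwoVec where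
  toFun w := (∑ i, polarCoords 1 z w i • E 1 i e, ∑ i, polarCoords (-1) z w i • E (-1) i e)
  map_add' w w' := by
    have h : ∀ s, polarCoords s z (w + w') = polarCoords s z w + polarCoords s z w' := by
      intro s
      ext i
      fin_cases i <;> simp [polarCoords, dualCoords, plucker] <;> ring
    simp only [h, Pi.add_apply, add_smul, Finset.sum_add_distrib, Prod.mk_add_mk]
  map_smul' r w := by
    have h : ∀ s, polarCoords s z (r • w) = r • polarCoords s z w := by
      intro s
      ext i
      fin_cases i <;> simp [polarCoords, dualCoords, plucker] <;> ring
    simp only [h, Pi.smul_apply, smul_eq_mul, mul_smul, Finset.smul_sum, RingHom.id_apply,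
      Prod.smul_mk]

theorem polarParts_apply (z w : C4) : polarParts z w
    = (∑ i, polarCoords 1 z w i • E 1 i e, ∑ i, polarCoords (-1) z w i • E (-1) i e) := rfl

theorem polarParts_smul {a : ℂ} (ha : Complex.normSq a = 1) (z w : C4) :
    polarParts (a • z) (a • w) = polarParts z w := by
  simp only [polarParts_apply, polarCoords_smul, ha, one_smul]

/-! ### Derivative and smoothness of the dual parts. -/

theorem hasDerivAt_plucker {γ : ℝ → C4} {w : C4} {t : ℝ} (h : HasDerivAt γ w t) (j k : Fin 4) :
    HasDerivAt (fun t => plucker (γ t) (γ t) j k) (plucker w (γ t) j k + plucker (γ t) w j k) t := by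
  have hre : ∀ j, HasDerivAt (fun t => (γ t j).re) (w j).re t := fun j =>
    Complex.reCLM.hasFDerivAt.comp_hasDerivAt t (hasDerivAt_pi.1 h j)
  have him : ∀ j, HasDerivAt (fun t => (γ t j).im) (w j).im t := fun j =>
    Complex.imCLM.hasFDerivAt.comp_hasDerivAt t (hasDerivAt_pi.1 h j)
  refine (((hre j).fun_mul (him k)).fun_sub ((hre k).fun_mul (him j))).congr_deriv ?_
  simp only [plucker]
  ring

theorem hasDerivAt_dualPart {γ : ℝ → C4} {w : C4} {t : ℝ} (h : HasDerivAt γ w t) (s : ℝ) :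
    HasDerivAt (fun t => dualPart s (γ t)) (∑ i, polarCoords s (γ t) w i • E s i e) t := by
  refine HasDerivAt.fun_sum fun i _ => HasDerivAt.smul_const ?_ _
  have hp := hasDerivAt_plucker h
  fin_cases i
  · refine ((hp 0 1).fun_add ((hp 3 2).const_mul s)).congr_deriv ?_
    simp [polarCoords, dualCoords]; ring
  · refine ((hp 0 2).fun_add ((hp 3 1).const_mul s)).congr_deriv ?_
    simp [polarCoords, dualCoords]; ring
  · refine ((hp 0 3).fun_add ((hp 1 2).const_mul s)).congr_deriv ?_
    simp [polarCoords, dualCoords]; ring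

theorem hasDerivAt_dualParts {γ : ℝ → C4} {w : C4} {t : ℝ} (h : HasDerivAt γ w t) :
    HasDerivAt (fun t => dualParts (γ t)) (polarParts (γ t) w) t :=
  (hasDerivAt_dualPart h 1).prodMk (hasDerivAt_dualPart h (-1))

theorem contDiff_dualPart (s : ℝ) : ContDiff ℝ ∞ (dualPart s) := by
  have hre : ∀ j, ContDiff ℝ ∞ (fun z : C4 => (z j).re) := fun j =>
    Complex.reCLM.contDiff.comp (contDiff_apply ℝ ℂ j)
  have him : ∀ j, ContDiff ℝ ∞ (fun z : C4 => (z j).im) := fun j =>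
    Complex.imCLM.contDiff.comp (contDiff_apply ℝ ℂ j)
  have hp : ∀ j k, ContDiff ℝ ∞ (fun z : C4 => plucker z z j k) := fun j k =>
    ((hre j).mul (him k)).sub ((hre k).mul (him j))
  refine ContDiff.sum fun i _ => ContDiff.fun_smul ?_ contDiff_const
  fin_cases i
  · exact (hp 0 1).add (contDiff_const.mul (hp 3 2))
  · exact (hp 0 2).add (contDiff_const.mul (hp 3 1))
  · exact (hp 0 3).add (contDiff_const.mul (hp 1 2))

theorem contDiff_dualParts : ContDiff ℝ ∞ dualParts :=
  (contDiff_dualPart 1).prodMk (contDiff_dualPart (-1))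

theorem contDiff_coords (s : ℝ) : ContDiff ℝ ∞ (coords s) := by
  have : FiniteDimensional ℝ TwoVec := twoVecCoords.symm.finiteDimensional
  have h : ∀ x : TwoVec, ContDiff ℝ ∞ (fun v : TwoVec => form2 v x) := fun x =>
    (LinearMap.toContinuousLinearMap (form2.flip x)).contDiff
  rw [contDiff_pi]
  intro i
  fin_cases i
  · exact (h _).neg
  · exact h _
  · exact h _

/-! ### The holomorphic isometry -/

/-- The map `φ` on the quadric. -/
def quadricMap (ℓ : Q2star) : TwoVec × TwoVec :=
  planeMap (planeEquiv.symm ⟨ℓ.1, Q2star_subset_quadric ℓ.2⟩)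

theorem quadricMap_eq {ℓ : Q2star} {z : C4} (hz : z ∈ ℓ.1.submodule) (hz1 : z ∈ H73) :
    quadricMap ℓ = dualParts z :=
  planeMap_planeEquiv_symm _ hz hz1

theorem quadricMap_proj (z : Q2starLift) : quadricMap (proj z) = dualParts z.1 :=
  quadricMap_eq (mem_submodule_of_proj_eq rfl) z.2.1

theorem exists_unit_mem (ℓ : Q2star) :
    ∃ z ∈ ℓ.1.submodule, z ∈ H73 ∧ quad z z = 0 ∧ 0 < plucker z z 0 1 := by
  obtain ⟨z, hz, hz1, hq⟩ := exists_mem_H73 (Q2star_subset_quadric ℓ.2)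
  have h : ℓ.1 ∈ posQuadric := Q2star_eq ▸ ℓ.2
  exact ⟨z, hz, hz1, hq, h.2 z hz (ne_zero_of_mem_H73 hz1)⟩

theorem coords_dualPart {s : ℝ} (hs : s * s = 1) (z : C4) :
    coords s (dualPart s z) = dualCoords s z z := coords_sum_E s hs _

theorem quadricMap_injective : Function.Injective quadricMap := by
  intro ℓ m h
  obtain ⟨z, hz, hz1, hzq, -⟩ := exists_unit_mem ℓ
  obtain ⟨w, hw, hw1, hwq, -⟩ := exists_unit_mem m
  rw [quadricMap_eq hz hz1, quadricMap_eq hw hw1, dualParts, dualParts, Prod.mk.injEq] at h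
  have h1 := congrArg (coords 1) h.1
  have h2 := congrArg (coords (-1)) h.2
  rw [coords_dualPart (by norm_num), coords_dualPart (by norm_num)] at h1 h2
  obtain ⟨a, -, rfl⟩ := eq_smul_of_dualCoords_eq hz1 hzq hw1 hwq h1 h2
  exact Subtype.ext (eq_of_mem_submodule (ne_zero_of_mem_H73 hz1) hz (m.1.submodule.smul_mem a hw))

theorem mem_hypPlane_iff {s : ℝ} {x : TwoVec} :
    x ∈ hypPlane s (-4) ↔ ∃ y, IsHyp y ∧ x = ∑ i, y i • E s i e := by
  constructor
  · rintro ⟨y, rfl, h1, h0⟩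
    exact ⟨y, ⟨by rw [h1]; norm_num, h0⟩, rfl⟩
  · rintro ⟨y, ⟨h1, h0⟩, rfl⟩
    exact ⟨y, rfl, by rw [h1]; norm_num, h0⟩

/-- The section of the Hopf fibration on pairs of two-vectors. -/
def lift (x : TwoVec × TwoVec) : C4 := hopfSection (coords 1 x.1, coords (-1) x.2)

theorem isHyp_coords {s : ℝ} (hs : s * s = 1) {x : TwoVec} (hx : x ∈ hypPlane s (-4)) :
    IsHyp (coords s x) := by
  obtain ⟨y, hy, rfl⟩ := mem_hypPlane_iff.1 hx
  rwa [coords_sum_E s hs]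

theorem sum_coords {s : ℝ} (hs : s * s = 1) {x : TwoVec} (hx : x ∈ hypPlane s (-4)) :
    ∑ i, coords s x i • E s i e = x := by
  obtain ⟨y, hy, rfl⟩ := mem_hypPlane_iff.1 hx
  rw [coords_sum_E s hs]

theorem lift_mem {x : TwoVec × TwoVec} (hx : x ∈ hypPlane 1 (-4) ×ˢ hypPlane (-1) (-4)) :
    lift x ∈ Q2starLift := by
  have y1 := isHyp_coords (by norm_num) hx.1
  have y2 := isHyp_coords (by norm_num) hx.2
  refine ⟨hopfSection_mem_H73 y1 y2, ?_⟩
  rw [Q2star_eq]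
  exact hopfSection_hopf_mem y1 y2

theorem dualParts_lift {x : TwoVec × TwoVec} (hx : x ∈ hypPlane 1 (-4) ×ˢ hypPlane (-1) (-4)) :
    dualParts (lift x) = x := by
  have y1 := isHyp_coords (by norm_num) hx.1
  have y2 := isHyp_coords (by norm_num) hx.2
  refine Prod.ext ?_ ?_
  · simp only [dualParts, dualPart, lift, dualCoords_one_hopfSection y1 y2]
    exact sum_coords (by norm_num) hx.1
  · simp only [dualParts, dualPart, lift, dualCoords_neg_one_hopfSection y1 y2]
    exact sum_coords (by norm_num) hx.2

theorem range_quadricMap :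
    Set.range quadricMap = hypPlane 1 (-4) ×ˢ hypPlane (-1) (-4) := by
  apply Set.Subset.antisymm
  · rintro _ ⟨ℓ, rfl⟩
    obtain ⟨z, hz, hz1, hzq, hp⟩ := exists_unit_mem ℓ
    rw [quadricMap_eq hz hz1]
    exact ⟨mem_hypPlane_iff.2 ⟨_, isHyp_dualCoords (by norm_num) hz1 hzq hp, rfl⟩,
      mem_hypPlane_iff.2 ⟨_, isHyp_dualCoords (by norm_num) hz1 hzq hp, rfl⟩⟩
  · intro x hx
    exact ⟨proj ⟨lift x, lift_mem hx⟩, by rw [quadricMap_proj, dualParts_lift hx]⟩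

theorem isSmoothOnQ_quadricMap : IsSmoothOnQ quadricMap := fun _ =>
  ⟨Set.univ, dualParts, isOpen_univ, Set.mem_univ _, contDiff_dualParts.contDiffOn,
    fun w _ => quadricMap_proj w⟩

theorem contDiff_pair_coords :
    ContDiff ℝ ∞ (fun x : TwoVec × TwoVec => (coords 1 x.1, coords (-1) x.2)) :=
  ((contDiff_coords 1).comp contDiff_fst).prodMk ((contDiff_coords (-1)).comp contDiff_snd)

theorem exists_smooth_inverse :
    ∃ h : ↥(hypPlane 1 (-4) ×ˢ hypPlane (-1) (-4)) → Q2star,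
      (∀ x, quadricMap (h x) = x.1) ∧
        IsSmoothIntoQ (hypPlane 1 (-4) ×ˢ hypPlane (-1) (-4)) h := by
  refine ⟨fun x => proj ⟨lift x.1, lift_mem x.2⟩, fun x => ?_, fun x => ?_⟩
  · rw [quadricMap_proj, dualParts_lift x.2]
  · refine ⟨{x | 0 < secNorm (coords 1 x.1, coords (-1) x.2)}, lift, ?_, ?_, ?_, ?_⟩
    · exact isOpen_lt continuous_const
        (contDiff_secNorm.continuous.comp contDiff_pair_coords.continuous)
    · exact secNorm_pos (isHyp_coords (by norm_num) x.2.1) (isHyp_coords (by norm_num) x.2.2)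
    · exact contDiffOn_hopfSection.comp contDiff_pair_coords.contDiffOn fun _ hx => hx
    · exact fun y _ => ⟨lift_mem y.2, rfl⟩

theorem exists_differential (ℓ : Q2star) : ∃ D : tangentQ ℓ.1 →ₗ[ℝ] TwoVec × TwoVec,
    HasDifferentialAt quadricMap ℓ D ∧
    (∀ A B, metricHH (D A) (D B) = metricQ ℓ.1 A B) ∧
    (∀ A, D (complexStructureQ ℓ.1 A) = complexStructureHH (-4) (quadricMap ℓ) (D A)) := by
  obtain ⟨z, hz, hz1, hzq, -⟩ := exists_unit_mem ℓ
  -- The differential is read off at one unit vector of the line; by `polarParts_smul` any other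
  -- point of the Hopf fibre, differing by a phase, gives the same value.
  let D : tangentQ ℓ.1 →ₗ[ℝ] TwoVec × TwoVec :=
    { toFun := fun A => polarParts z (A.1 ⟨z, hz⟩)
      map_add' := fun A B => map_add (polarParts z) _ _
      map_smul' := fun r A => map_smul (polarParts z) r _ }
  have hD : ∀ A, D A = polarParts z (A.1 ⟨z, hz⟩) := fun A => rfl
  refine ⟨D, ?_, ?_, ?_⟩
  · intro A γ hγ hA
    have h0 := mem_submodule_of_proj_eq hγ
    have h := hasDerivAt_dualParts hA
    simp only [quadricMap_proj]
    have h0' := h0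
    rw [submodule_eq_span (ne_zero_of_mem_H73 hz1) hz] at h0'
    obtain ⟨a, ha⟩ := Submodule.mem_span_singleton.1 h0'
    have ha1 : Complex.normSq a = 1 := by
      have h1 : (herm _ _).re = -1 := (γ 0).2.1
      have h2 : (herm _ _).re = -1 := hz1
      rw [← ha, herm_smul_smul, Complex.re_ofReal_mul, h2] at h1
      linarith
    have hs : (⟨(γ 0).1, h0⟩ : ℓ.1.submodule) = a • ⟨z, hz⟩ := Subtype.ext ha.symm
    rw [hs, map_smul, ← ha, polarParts_smul ha1] at h
    exact h
  · intro A B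
    obtain ⟨hA1, hA2⟩ := A.2 ⟨z, hz⟩
    obtain ⟨hB1, hB2⟩ := B.2 ⟨z, hz⟩
    rw [metricQ_eq ℓ.1 A B ⟨z, hz⟩ hz1, hD, hD, metricHH, polarParts_apply, polarParts_apply,
      form2_sum_E 1 (by norm_num), form2_sum_E (-1) (by norm_num)]
    exact lorentz_polarCoords hz1 hzq hA1 hA2 hB1 hB2
  · intro A
    obtain ⟨hA1, hA2⟩ := A.2 ⟨z, hz⟩
    have hI : (complexStructureQ ℓ.1 A).1 ⟨z, hz⟩ = Complex.I • A.1 ⟨z, hz⟩ := rfl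
    -- `√(-c) = 2` is the factor from `polarCoords_I_smul`; this is where the curvature `-4` enters
    -- the complex structure.
    have h4 : √(-(-4)) = (2 : ℝ) := by
      rw [neg_neg, show (4 : ℝ) = 2 ^ 2 by norm_num, Real.sqrt_sq (by norm_num)]
    rw [hD, hD, hI, polarParts_apply, polarParts_apply, complexStructureHH, h4,
      polarCoords_I_smul (by norm_num) hz1 hzq hA1 hA2,
      polarCoords_I_smul (by norm_num) hz1 hzq hA1 hA2, quadricMap_eq hz hz1]
    simp only [dualParts, cross2]
    rw [coords_dualPart (by norm_num), coords_dualPart (by norm_num), coords_sum_E 1 (by norm_num),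
      coords_sum_E (-1) (by norm_num), Prod.smul_mk]
    congr 1
    · simp only [Finset.smul_sum, smul_smul, Pi.smul_apply, smul_eq_mul, mul_one]
    · simp only [Finset.smul_sum, smul_smul, Pi.smul_apply, smul_eq_mul,
        ← Finset.sum_neg_distrib, ← neg_smul]
      refine Finset.sum_congr rfl fun i _ => ?_
      congr 1
      ring

theorem isHolomorphicIsometry_quadricMap : IsHolomorphicIsometry (-4) quadricMap where
  injective := quadricMap_injective
  range_eq := range_quadricMap
  smooth := isSmoothOnQ_quadricMap
  smooth_inverse := exists_smooth_inverse
  differential := exists_differential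

end HypQuadric

end

open HypQuadric in
theorem mainTheorem7 :
    ∃ (φ : NegOrientedPlane → TwoVec × TwoVec) (ι : NegOrientedPlane ≃ quadric),
      (∀ P, ∃ u, IsAdaptedBasis P u) ∧
      (∀ P u, IsAdaptedBasis P u →
        φ P = ((1 / 2 : ℝ) • E 1 0 u, (1 / 2 : ℝ) • E (-1) 0 u)) ∧
      (∀ P u, IsAdaptedBasis P u →
        (ι P).1.submodule = Submodule.span ℂ {complexVec u}) ∧
      (∀ P, (φ P).1 ∈ selfDual ∧ (φ P).2 ∈ antiSelfDual) ∧
      IsHolomorphicIsometry (-4)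
        (fun ℓ : Q2star => φ (ι.symm ⟨ℓ.1, Q2star_subset_quadric ℓ.2⟩)) :=
  ⟨planeMap, planeEquiv, exists_isAdaptedBasis, fun _ _ => planeMap_eq,
    fun _ _ => planeLine_submodule, planeMap_mem, isHolomorphicIsometry_quadricMap⟩
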